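/- Let $\delta,d>0$ and let $f:C([-\delta,0],\mathbb R^n)\times\mathbb R^p\to\mathbb R^n$ satisfy $f(0,0)=0$ and, for some $L_f>0$, $$\|f(\phi,u)-f(\varphi,v)\|\le L_f\big(\|\phi-\varphi\|_c+\|u-v\|\big)\qquad\text{for all }\phi,\varphi,u,v,$$ where $\|\cdot\|$ is the Euclidean norm and $\|\cdot\|_c$ the supremum norm. For a function $x$ write $x_t(\theta)=x(t+\theta)$, $\theta\in[-\delta,0]$. Let $\alpha:\mathbb R^n\to\mathbb R^p$ be globally Lipschitz with $\alpha(0)=0$, and assume that the retarded system $\dot x(t)=f(x_t,\alpha(x(t)))$ is globally exponentially stable: there are $a_1,a_2>0$ such that every solution satisfies $\|x(t)\|\le a_1\|x_0\|_c e^{-a_2t}$ for all $t\ge 0$. Let $m$ be an integer with $m>(L_f+1)^2d$. Then the system with input delay $\dot x(t)=f(x_t,u(t-d))$, $t\ge0$, is rendered globally asymptotically stable by the controller $u(t)=\alpha(z_m(t))$, $t\ge 0$, with the sequential predictors (where $z_0:=x$ and $z^i_t(\theta)=z_i(t+\theta)$, $\theta\in[-\delta,0]$) $$\dot z_i(t)=f\Big(z^i_t,\,u\big(t-d+\tfrac{id}{m}\big)\Big)-(L_f+1)\Big(z_i\big(t-\tfrac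 dm\big)-z_{i-1}(t)\Big),\qquad i=1,\dots,m,\ t\ge 0 .$$ That is, there is a function $\beta$ of class $\mathcal{KL}$ such that for all initial histories $\psi\in C([-\delta,0],\mathbb R^n)$ of $x$ and $\phi_i\in C([-\max(\delta,d/m),0],\mathbb R^n)$ of $z_i$, and every initial input $\upsilon\in C([-d,0],\mathbb R^p)$ (that is, $u=\upsilon$ on $[-d,0)$; in particular for $\upsilon=0$), the closed-loop system has a solution on $[0,\infty)$, and every solution satisfies $$\max\{\|x(t)\|,\|z_1(t)\|,\dots,\|z_m(t)\|\}\le\beta\big(\max\{\|\psi\|_c,\|\phi_1\|_c,\dots,\|\phi_m\|_c,\|\upsilon\|_c\},\,t\big),\qquad t\ge 0 .$$ (Solutions are continuous, and derivatives are right-hand derivatives, since $u$ may jump at time $0$.) -/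

import Mathlib

/-- The segment `x_t ∈ C([-δ,0], E)` of a trajectory, `x_t(θ) = x(t + θ)`. -/
def historySegment {E : Type*} [TopologicalSpace E] (δ : ℝ) (x : C(ℝ, E)) (t : ℝ) :
    C(Set.Icc (-δ) (0 : ℝ), E) where
  toFun θ := x (t + θ)
  continuous_toFun := by fun_prop

/-- `x` solves `ẋ(t) = f(x_t, α(x(t)))`, `t ≥ 0`, with `x_0 = ψ`. Trajectories are continuous
functions on `ℝ` of which only the values on `[-δ, ∞)` matter. The derivative is the right-hand
one; as the right-hand side is continuous in `t`, for `t > 0` it is the ordinary derivative. -/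
structure IsDelayFreeSolution {n p : ℕ} (δ : ℝ)
    (f : C(Set.Icc (-δ) (0 : ℝ), EuclideanSpace ℝ (Fin n)) →
      EuclideanSpace ℝ (Fin p) → EuclideanSpace ℝ (Fin n))
    (α : EuclideanSpace ℝ (Fin n) → EuclideanSpace ℝ (Fin p))
    (ψ : C(Set.Icc (-δ) (0 : ℝ), EuclideanSpace ℝ (Fin n)))
    (x : C(ℝ, EuclideanSpace ℝ (Fin n))) : Prop where
  init : ∀ θ : Set.Icc (-δ) (0 : ℝ), x θ = ψ θ
  eqn : ∀ t : ℝ, 0 ≤ t →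
    HasDerivWithinAt x (f (historySegment δ x t) (α (x t))) (Set.Ici t) t

/-- Global exponential stability of `ẋ(t) = f(x_t, α(x(t)))`. -/
def IsDelayFreeGES {n p : ℕ} (δ : ℝ)
    (f : C(Set.Icc (-δ) (0 : ℝ), EuclideanSpace ℝ (Fin n)) →
      EuclideanSpace ℝ (Fin p) → EuclideanSpace ℝ (Fin n))
    (α : EuclideanSpace ℝ (Fin n) → EuclideanSpace ℝ (Fin p)) : Prop :=
  ∃ a₁ a₂ : ℝ, 0 < a₁ ∧ 0 < a₂ ∧
    ∀ (ψ : C(Set.Icc (-δ) (0 : ℝ), EuclideanSpace ℝ (Fin n)))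
      (x : C(ℝ, EuclideanSpace ℝ (Fin n))), IsDelayFreeSolution δ f α ψ x →
      ∀ t : ℝ, 0 ≤ t → ‖x t‖ ≤ a₁ * ‖ψ‖ * Real.exp (-a₂ * t)

/-- The closed loop of the plant `ẋ(t) = f(x_t, u(t-d))` with the controller `u(t) = α(z_m(t))` and
the sequential predictors `z_1, …, z_m`. Here `z 0 = x`, and the index `i : Fin m` stands for the
predictor number `i + 1`, which is `z i.succ`, its predecessor being `z i.castSucc`.

The initial data are the history `ψ` of the plant on `[-δ, 0]`, the histories `φ i` of the
predictors on `[-max(δ, d/m), 0]`, and the initial input `υ` on `[-d, 0)`. The choice `υ = 0` is the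
system started with zero input, and `υ = α ∘ z_m` is the system in which the feedback
`u = α(z_m)` acts from time `-d` on.

The input `u` may jump at time `0`, hence the right-hand derivatives: all right-hand sides are
right-continuous, and wherever they are continuous the derivative is the ordinary one. -/
structure IsClosedLoopSolution {n p : ℕ} (δ d L : ℝ) (m : ℕ)
    (f : C(Set.Icc (-δ) (0 : ℝ), EuclideanSpace ℝ (Fin n)) →
      EuclideanSpace ℝ (Fin p) → EuclideanSpace ℝ (Fin n))
    (α : EuclideanSpace ℝ (Fin n) → EuclideanSpace ℝ (Fin p))
    (ψ : C(Set.Icc (-δ) (0 : ℝ), EuclideanSpace ℝ (Fin n)))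
    (φ : Fin m → C(Set.Icc (-(max δ (d / m))) (0 : ℝ), EuclideanSpace ℝ (Fin n)))
    (υ : C(Set.Icc (-d) (0 : ℝ), EuclideanSpace ℝ (Fin p)))
    (z : Fin (m + 1) → C(ℝ, EuclideanSpace ℝ (Fin n)))
    (u : ℝ → EuclideanSpace ℝ (Fin p)) : Prop where
  init_plant : ∀ θ : Set.Icc (-δ) (0 : ℝ), z 0 θ = ψ θ
  init_predictor : ∀ (i : Fin m) (θ : Set.Icc (-(max δ (d / m))) (0 : ℝ)), z i.succ θ = φ i θ
  init_input : ∀ θ : Set.Icc (-d) (0 : ℝ), (θ : ℝ) < 0 → u θ = υ θ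
  feedback : ∀ t : ℝ, 0 ≤ t → u t = α (z (Fin.last m) t)
  plant : ∀ t : ℝ, 0 ≤ t →
    HasDerivWithinAt (z 0) (f (historySegment δ (z 0) t) (u (t - d))) (Set.Ici t) t
  predictor : ∀ (i : Fin m) (t : ℝ), 0 ≤ t →
    HasDerivWithinAt (z i.succ)
      (f (historySegment δ (z i.succ) t) (u (t - d + ((i : ℝ) + 1) * d / m))
        - (L + 1) • (z i.succ (t - d / m) - z i.castSucc t))
      (Set.Ici t) t

/-- Functions of class `𝒦𝓛` on `[0,∞) × [0,∞)`. -/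
structure IsClassKL (β : ℝ → ℝ → ℝ) : Prop where
  continuousOn : ∀ t : ℝ, 0 ≤ t → ContinuousOn (fun s => β s t) (Set.Ici 0)
  strictMonoOn : ∀ t : ℝ, 0 ≤ t → StrictMonoOn (fun s => β s t) (Set.Ici 0)
  zero : ∀ t : ℝ, 0 ≤ t → β 0 t = 0
  antitoneOn : ∀ s : ℝ, 0 ≤ s → AntitoneOn (β s) (Set.Ici 0)
  tendsto : ∀ s : ℝ, 0 ≤ s → Filter.Tendsto (β s) Filter.atTop (nhds 0)

/-- Global asymptotic stability of the closed loop: for all initial data a solution exists on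
`[0, ∞)`, and with one `β` of class `𝒦𝓛` every solution satisfies
`‖(x(t), z_1(t), …, z_m(t))‖ ≤ β(‖(ψ, φ, υ)‖, t)`, `t ≥ 0`, where the norms of the tuples are the
maxima of the norms of the entries (the Euclidean norm for points and the supremum norm for
continuous functions). -/
def IsClosedLoopGAS {n p : ℕ} (δ d L : ℝ) (m : ℕ)
    (f : C(Set.Icc (-δ) (0 : ℝ), EuclideanSpace ℝ (Fin n)) →
      EuclideanSpace ℝ (Fin p) → EuclideanSpace ℝ (Fin n))
    (α : EuclideanSpace ℝ (Fin n) → EuclideanSpace ℝ (Fin p)) : Prop :=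
  ∃ β : ℝ → ℝ → ℝ, IsClassKL β ∧
    ∀ (ψ : C(Set.Icc (-δ) (0 : ℝ), EuclideanSpace ℝ (Fin n)))
      (φ : Fin m → C(Set.Icc (-(max δ (d / m))) (0 : ℝ), EuclideanSpace ℝ (Fin n)))
      (υ : C(Set.Icc (-d) (0 : ℝ), EuclideanSpace ℝ (Fin p))),
      (∃ z u, IsClosedLoopSolution δ d L m f α ψ φ υ z u) ∧
      ∀ z u, IsClosedLoopSolution δ d L m f α ψ φ υ z u →
        ∀ t : ℝ, 0 ≤ t → ‖fun i => z i t‖ ≤ β ‖(ψ, φ, υ)‖ t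

/-! Write h = d/m, k = L + 1 and e_i(t) = z_i(t - h) - z_{i-1}(t). The input shifts are staggered so
that z_i at time t - h and z_{i-1} at time t receive the same input value. The input therefore
cancels from the error equation ė_i(t) = g(t) - k e_i(t - h), in which |g(t)| is at most L times the
supremum of |e_i| over [t - δ, t] plus the size of the correction term of z_{i-1}, namely k
|e_{i-1}(t)| (zero for the plant). So the errors form a cascade whose decay can be proved before
anything is known about the plant.

One error equation is treated in `exp_decay_of_delayed_feedback`. Integration over [t - h, t] gives
e(t) = (1 - kh) e(t - h) + R, so the delayed feedback is -c e(t) + cR with c = k/(1 - kh). Bounding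
R by the supremum of the recent past and multiplying the requirement "gain less than c" by 1 - kh
leaves L + (kh)²(2L + 1) < L + 1. As 2L + 1 ≤ (L + 1)², this follows from m > (L + 1)² d
(`delayed_feedback_gain_lt`). The strict margin leaves room for a small decay rate λ.

The errors telescope to v(t) = z_m(t - d) - x(t), so v decays exponentially and the plant obeys the
delay-free equation with feedback α(x + v). `IsDelayFreeGES.exists_perturbed_decay` shows that x
then decays: over a long enough period the unperturbed flow halves the history norm, and
Gronwall-type comparison controls the effect of v. Adding the errors back gives decay of every z_i.
All constants are linear in the size of the data, so β(s, t) = C s exp(-λt). -/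

open Set Filter Topology

/-! ### Barrier comparison and global existence -/

/-- A curve that starts below a barrier stays below it, if its speed is smaller than that of the
barrier as long as it has stayed below the barrier. -/
theorem norm_le_of_norm_deriv_lt_of_past {E : Type*} [NormedAddCommGroup E] [NormedSpace ℝ E]
    {y y' : ℝ → E} {b b' : ℝ → ℝ} {a : ℝ} (hy : Continuous y) (hb : Continuous b)
    (hy' : ∀ t, a ≤ t → HasDerivWithinAt y (y' t) (Ici t) t)
    (hb' : ∀ t, a ≤ t → HasDerivAt b (b' t) t) (ha : ‖y a‖ ≤ b a)
    (hlt : ∀ t, a ≤ t → (∀ s ∈ Icc a t, ‖y s‖ ≤ b s) → ‖y' t‖ < b' t) :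
    ∀ t, a ≤ t → ‖y t‖ ≤ b t := by
  intro T hT
  set S : Set ℝ := {t | ∀ s ∈ Icc a t, ‖y s‖ ≤ b s} with hS
  have hclosed : IsClosed (S ∩ Icc a T) := by
    rw [isClosed_iff_clusterPt]
    intro t ht
    have htm : t ∈ closure (S ∩ Icc a T) := mem_closure_iff_clusterPt.2 ht
    have htI : t ∈ Icc a T := by
      have := closure_mono (inter_subset_right (s := S)) htm
      rwa [isClosed_Icc.closure_eq] at this
    refine ⟨?_, htI⟩
    have hlt' : ∀ s, a ≤ s → s < t → ‖y s‖ ≤ b s := by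
      intro s has hst
      obtain ⟨r, hr, hrS, -⟩ := mem_closure_iff.1 htm (Ioi s) isOpen_Ioi hst
      exact hrS s ⟨has, le_of_lt hr⟩
    intro s hs
    rcases hs.2.lt_or_eq with h | rfl
    · exact hlt' s hs.1 h
    rcases hs.1.lt_or_eq with h | rfl
    · have hc : IsClosed {r | ‖y r‖ ≤ b r} := isClosed_le hy.norm hb
      have : closure (Ioo a s) ⊆ {r | ‖y r‖ ≤ b r} :=
        hc.closure_subset_iff.2 fun r hr => hlt' r hr.1.le hr.2
      rw [closure_Ioo h.ne] at this
      exact this ⟨h.le, le_rfl⟩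
    · exact ha
  have haS : a ∈ S := by
    intro s hs
    rw [le_antisymm hs.2 hs.1]
    exact ha
  -- Continuous induction on [a, T]. At a time of `S` the right slope of the norm is strictly below
  -- that of the barrier, so the bound persists a little further.
  have key : Icc a T ⊆ S := by
    refine hclosed.Icc_subset_of_forall_mem_nhdsWithin haS ?_
    rintro t ⟨htS, htI⟩
    have hl := hlt t htI.1 htS
    obtain ⟨r, hr1, hr2⟩ := exists_between hl
    have h1 : ∀ᶠ s in 𝓝[>] t, ‖s - t‖⁻¹ * ‖y s - y t‖ < r :=
      ((hy' t htI.1).mono Ioi_subset_Ici_self).limsup_norm_slope_le hr1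
    have h2 : ∀ᶠ s in 𝓝[>] t, r < slope b t s :=
      ((hasDerivWithinAt_iff_tendsto_slope' (self_notMem_Ioi)).1
        (hb' t htI.1).hasDerivWithinAt).eventually_const_lt hr2
    have h3 : ∀ᶠ s in 𝓝[>] t, ‖y s‖ ≤ b s := by
      filter_upwards [h1, h2, self_mem_nhdsWithin] with s hs1 hs2 hs3
      have hpos : 0 < s - t := sub_pos.2 hs3
      rw [Real.norm_of_nonneg hpos.le, inv_mul_lt_iff₀ hpos] at hs1
      rw [slope_def_field, lt_div_iff₀ hpos] at hs2
      have := norm_sub_norm_le (y s) (y t)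
      have := htS t ⟨htI.1, le_rfl⟩
      nlinarith
    obtain ⟨u, hu, hu'⟩ := mem_nhdsGT_iff_exists_Ioo_subset.1 h3
    refine mem_of_superset (Ioo_mem_nhdsGT hu) fun s hs r hr => ?_
    rcases le_or_gt r t with h | h
    · exact htS r ⟨hr.1, h⟩
    · exact hu' ⟨h, hr.2.trans_lt hs.2⟩
  exact key ⟨hT, le_rfl⟩ T ⟨hT, le_rfl⟩

/-- Global existence for a causal, globally Lipschitz functional differential equation. -/
theorem exists_solution_of_causal_lipschitz {E : Type*} [NormedAddCommGroup E] [NormedSpace ℝ E]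
    [CompleteSpace E] (F : C(ℝ, E) → ℝ → E) {K C M : ℝ} (hK : 0 < K)
    (hLip : ∀ (Y Y' : C(ℝ, E)) (t : ℝ), 0 ≤ t → ∀ R : ℝ, (∀ s ≤ t, ‖Y s - Y' s‖ ≤ R) →
      ‖F Y t - F Y' t‖ ≤ K * R)
    (hcont : ∀ (Y : C(ℝ, E)) (t : ℝ), 0 ≤ t → ContinuousWithinAt (F Y) (Ici t) t)
    (hmeas : ∀ Y : C(ℝ, E), MeasureTheory.StronglyMeasurable (F Y))
    (hF0 : ∀ t, 0 ≤ t → ‖F 0 t‖ ≤ C) (Y₀ : C(ℝ, E)) (hM : ∀ t, ‖Y₀ t‖ ≤ M)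
    (hY₀ : ∀ t, 0 ≤ t → Y₀ t = Y₀ 0) :
    ∃ Y : C(ℝ, E), (∀ t ≤ 0, Y t = Y₀ t) ∧
      ∀ t, 0 ≤ t → HasDerivWithinAt Y (F Y t) (Ici t) t := by
  -- Picard iteration in a sup norm weighted by exp(-lam t): integrating K exp(lam s) gains the
  -- factor K/lam = 1/2, so the map contracts on all of [0, ∞) at once. The unknown is the bounded
  -- function `w` with Y = Y₀ + exp(lam max(t, 0)) w.
  set lam : ℝ := 2 * K with hlam
  have hlam0 : 0 < lam := by positivity
  have hC0 : 0 ≤ C := (norm_nonneg _).trans (hF0 0 le_rfl)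
  have hM0 : 0 ≤ M := (norm_nonneg _).trans (hM 0)
  let W : BoundedContinuousFunction ℝ E → C(ℝ, E) := fun w =>
    ⟨fun t => Y₀ t + Real.exp (lam * max t 0) • w t, by fun_prop⟩
  have hW : ∀ w t, W w t = Y₀ t + Real.exp (lam * max t 0) • w t := fun _ _ => rfl
  have hWnorm : ∀ w t, 0 ≤ t → ∀ s ≤ t, ‖W w s‖ ≤ M + Real.exp (lam * t) * ‖w‖ := by
    intro w t ht s hs
    rw [hW]
    refine (norm_add_le _ _).trans (add_le_add (hM s) ?_)
    rw [norm_smul, Real.norm_of_nonneg (Real.exp_pos _).le]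
    have : max s 0 ≤ t := max_le hs ht
    gcongr
    exact w.norm_coe_le_norm s
  have hFW : ∀ w t, 0 ≤ t → ‖F (W w) t‖ ≤ C + K * (M + Real.exp (lam * t) * ‖w‖) := by
    intro w t ht
    have h1 := hLip (W w) 0 t ht _ (fun s hs => by simpa using hWnorm w t ht s hs)
    have h2 := norm_sub_norm_le (F (W w) t) (F 0 t)
    have h3 := hF0 t ht
    linarith
  let G : BoundedContinuousFunction ℝ E → ℝ → E := fun w s => F (W w) (max s 0)
  have hGmeas : ∀ w, MeasureTheory.StronglyMeasurable (G w) := fun w =>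
    (hmeas (W w)).comp_measurable (by fun_prop)
  have hGint : ∀ w a b, IntervalIntegrable (G w) MeasureTheory.volume a b := by
    intro w a b
    rw [intervalIntegrable_iff]
    refine MeasureTheory.Measure.integrableOn_of_bounded
      (M := C + K * (M + Real.exp (lam * max (max a b) 0) * ‖w‖)) (by simp)
      (hGmeas w).aestronglyMeasurable ?_
    refine (MeasureTheory.ae_restrict_iff' measurableSet_uIoc).2
        (MeasureTheory.ae_of_all _ fun s hs => ?_)
    refine (hFW w _ (le_max_right _ _)).trans ?_
    have : s ≤ max a b := hs.2
    gcongr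
  have hPc : ∀ w, Continuous fun t => ∫ s in (0 : ℝ)..t, G w s := fun w =>
    intervalIntegral.continuous_primitive (hGint w) 0
  have hexpint : ∀ t : ℝ, ∫ s in (0 : ℝ)..t, Real.exp (lam * s) = (Real.exp (lam * t) - 1) / lam := by
    intro t
    rw [intervalIntegral.integral_comp_mul_left (fun s => Real.exp s) hlam0.ne', integral_exp]
    simp [div_eq_inv_mul]
  have hPbound : ∀ w t, 0 ≤ t → ‖∫ s in (0 : ℝ)..t, G w s‖ ≤
      (C + K * (M + ‖w‖)) / lam * Real.exp (lam * t) := by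
    intro w t ht
    have h1 : ‖∫ s in (0 : ℝ)..t, G w s‖ ≤
        ∫ s in (0 : ℝ)..t, (C + K * (M + ‖w‖)) * Real.exp (lam * s) := by
      refine intervalIntegral.norm_integral_le_of_norm_le ht
        (MeasureTheory.ae_of_all _ fun s hs => ?_)
        (Continuous.intervalIntegrable (by fun_prop) _ _)
      refine (hFW w _ (le_max_right _ _)).trans ?_
      rw [max_eq_left hs.1.le]
      have : 1 ≤ Real.exp (lam * s) := Real.one_le_exp (by have := hs.1; positivity)
      have e : (C + K * (M + ‖w‖)) * Real.exp (lam * s) =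
        C * Real.exp (lam * s) + K * (M * Real.exp (lam * s) + Real.exp (lam * s) * ‖w‖) := by ring
      rw [e]
      gcongr
      · exact le_mul_of_one_le_right hC0 this
      · exact le_mul_of_one_le_right hM0 this
    refine h1.trans ?_
    rw [intervalIntegral.integral_const_mul, hexpint, mul_div_assoc', div_mul_eq_mul_div]
    gcongr
    linarith
  let Φ : BoundedContinuousFunction ℝ E → BoundedContinuousFunction ℝ E := fun w =>
    BoundedContinuousFunction.ofNormedAddCommGroup
      (fun t => Real.exp (-(lam * max t 0)) • ∫ s in (0 : ℝ)..max t 0, G w s)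
      (Continuous.smul (by fun_prop) ((hPc w).comp (by fun_prop)))
      ((C + K * (M + ‖w‖)) / lam) (by
        intro t
        rw [norm_smul, Real.norm_of_nonneg (Real.exp_pos _).le, Real.exp_neg,
          inv_mul_le_iff₀ (Real.exp_pos _), mul_comm (Real.exp _)]
        exact hPbound w _ (le_max_right _ _))
  have hΦ : ∀ w t, Φ w t = Real.exp (-(lam * max t 0)) • ∫ s in (0 : ℝ)..max t 0, G w s :=
    fun _ _ => rfl
  have hcontr : ContractingWith (1 / 2) Φ := by
    refine ⟨by rw [← NNReal.coe_lt_coe]; norm_num, LipschitzWith.of_dist_le_mul fun w w' => ?_⟩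
    refine (BoundedContinuousFunction.dist_le (by positivity)).2 fun t => ?_
    rw [hΦ, hΦ, dist_eq_norm, ← smul_sub, norm_smul, Real.norm_of_nonneg (Real.exp_pos _).le,
      Real.exp_neg, inv_mul_le_iff₀ (Real.exp_pos _),
      ← intervalIntegral.integral_sub (hGint _ _ _) (hGint _ _ _)]
    have h1 : ‖∫ s in (0 : ℝ)..max t 0, (G w s - G w' s)‖ ≤
        ∫ s in (0 : ℝ)..max t 0, (K * dist w w') * Real.exp (lam * s) := by
      refine intervalIntegral.norm_integral_le_of_norm_le (le_max_right _ _)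
        (MeasureTheory.ae_of_all _ fun s hs => ?_) (Continuous.intervalIntegrable (by fun_prop) _ _)
      have hs0 : max s 0 = s := max_eq_left hs.1.le
      rw [mul_assoc]
      simp only [G, hs0]
      refine hLip _ _ _ hs.1.le _ fun r hr => ?_
      rw [hW, hW, add_sub_add_left_eq_sub, ← smul_sub, norm_smul,
        Real.norm_of_nonneg (Real.exp_pos _).le, mul_comm, ← dist_eq_norm]
      have : max r 0 ≤ s := max_le hr hs.1.le
      gcongr
      exact BoundedContinuousFunction.dist_coe_le_dist r
    refine h1.trans ?_
    rw [intervalIntegral.integral_const_mul, hexpint]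
    have : K * dist w w' * ((Real.exp (lam * max t 0) - 1) / lam) =
        (1 / 2) * dist w w' * (Real.exp (lam * max t 0) - 1) := by
      rw [hlam]; field_simp
    rw [this]
    have h0 : 0 ≤ dist w w' := dist_nonneg
    have : (((1 / 2 : NNReal) : ℝ)) = 1 / 2 := by norm_num
    rw [this]
    nlinarith
  set w := ContractingWith.fixedPoint Φ hcontr with hw
  have hfix : Φ w = w := hcontr.fixedPoint_isFixedPt
  have hYeq : ∀ t, W w t = Y₀ t + ∫ s in (0 : ℝ)..max t 0, G w s := by
    intro t
    rw [hW]
    nth_rewrite 1 [← hfix]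
    rw [hΦ, smul_smul, ← Real.exp_add]
    simp
  refine ⟨W w, fun t ht => by rw [hYeq]; simp [max_eq_right ht], fun t ht => ?_⟩
  -- Right continuity of the integrand is all that is available when the input jumps, and it
  -- suffices for a right derivative of the integral.
  have hGc : ContinuousWithinAt (G w) (Ici t) t := by
    refine (hcont (W w) t ht).congr (fun s hs => ?_) ?_
    · simp only [G, max_eq_left (ht.trans hs)]
    · simp only [G, max_eq_left ht]
  have h := intervalIntegral.integral_hasDerivWithinAt_right (s := Ici t) (t := Ioi t)
    (hGint w 0 t)
    ((hGmeas w).stronglyMeasurableAtFilter) (hGc.mono Ioi_subset_Ici_self)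
  have hG : G w t = F (W w) t := by simp only [G, max_eq_left ht]
  rw [hG] at h
  refine (h.const_add (Y₀ 0)).congr (fun s hs => ?_) ?_
  · rw [hYeq, max_eq_left (ht.trans hs), hY₀ s (ht.trans hs)]
  · rw [hYeq, max_eq_left ht, hY₀ t ht]

/-! ### Exponential decay under delayed feedback -/

/-- The delayed feedback `-k e(t - h)` acts like an undelayed feedback `-c e(t)` with
`c = k / (1 - k h)`, up to an error that is quadratic in `k h`. -/
theorem norm_deriv_add_smul_le_of_delayed_feedback {E : Type*} [NormedAddCommGroup E]
    [NormedSpace ℝ E] {e g : ℝ → E} {k h L M w t : ℝ} (hk : 0 < k) (hh : 0 < h) (hkh : k * h < 1)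
    (he : Continuous e)
    (he' : ∀ s ∈ Icc (t - 2 * h) t, HasDerivWithinAt e (g s - k • e (s - h)) (Ici s) s)
    (hg : ∀ s ∈ Icc (t - 2 * h) t, ‖g s‖ ≤ L * M + w)
    (hM : ∀ s ∈ Icc (t - 3 * h) t, ‖e s‖ ≤ M) :
    ‖g t - k • e (t - h) + (k / (1 - k * h)) • e t‖ ≤
      (L * M + w) + k / (1 - k * h) * (h * (L * M + w + k * ((L * M + w + k * M) * h))) := by
  have ha : 0 < 1 - k * h := by linarith
  have hP : 0 ≤ L * M + w + k * M := by
    have h1 := (norm_nonneg _).trans (hg t ⟨by linarith, le_rfl⟩)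
    have h2 := (norm_nonneg _).trans (hM t ⟨by linarith, le_rfl⟩)
    positivity
  -- The speed of e is at most L M + w + k M, and r is within h of t - h.
  have hback : ∀ r ∈ Icc (t - 2 * h) (t - h), ‖e (t - h) - e r‖ ≤ (L * M + w + k * M) * h := by
    intro r hr
    have := norm_image_sub_le_of_norm_deriv_right_le_segment (f := e) (a := r) (b := t - h)
      (C := L * M + w + k * M) he.continuousOn
      (fun s hs => he' s ⟨hr.1.trans hs.1, by linarith [hs.2]⟩)
      (fun s hs => by
        refine (norm_sub_le _ _).trans
          (add_le_add (hg s ⟨hr.1.trans hs.1, by linarith [hs.2]⟩) ?_)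
        rw [norm_smul, Real.norm_of_nonneg hk.le]
        gcongr
        exact hM _ ⟨by linarith [hr.1, hs.1], by linarith [hs.2]⟩) (t - h) ⟨hr.2, le_rfl⟩
    refine this.trans (mul_le_mul_of_nonneg_left ?_ hP)
    linarith [hr.1]
  -- Freezing the feedback at k e(t - h) makes the right-hand side constant up to g and k (e(t - h)
  -- - e(s - h)), the latter small by `hback`. The added linear term s k e(t - h) absorbs the frozen
  -- part.
  have hR : ‖e t - (1 - k * h) • e (t - h)‖ ≤
      h * (L * M + w + k * ((L * M + w + k * M) * h)) := by
    have := norm_image_sub_le_of_norm_deriv_right_le_segment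
      (f := fun s => e s + s • (k • e (t - h))) (a := t - h) (b := t)
      (f' := fun s => (g s - k • e (s - h)) + (1 : ℝ) • (k • e (t - h)))
      (C := L * M + w + k * ((L * M + w + k * M) * h)) (by fun_prop)
      (fun s hs => (he' s ⟨by linarith [hs.1], hs.2.le⟩).add
        ((hasDerivWithinAt_id s _).smul_const (k • e (t - h))))
      (fun s hs => by
        have e1 : (g s - k • e (s - h)) + (1 : ℝ) • (k • e (t - h)) =
          g s + k • (e (t - h) - e (s - h)) := by module
        rw [e1]
        refine (norm_add_le _ _).trans (add_le_add (hg s ⟨by linarith [hs.1], hs.2.le⟩) ?_)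
        rw [norm_smul, Real.norm_of_nonneg hk.le]
        gcongr
        exact hback _ ⟨by linarith [hs.1], by linarith [hs.2]⟩) t ⟨by linarith, le_rfl⟩
    have e2 : e t - (1 - k * h) • e (t - h) =
        (e t + t • (k • e (t - h))) - (e (t - h) + (t - h) • (k • e (t - h))) := by module
    rw [e2]
    refine this.trans (le_of_eq ?_)
    ring
  have e3 : g t - k • e (t - h) + (k / (1 - k * h)) • e t =
      g t + (k / (1 - k * h)) • (e t - (1 - k * h) • e (t - h)) := by
    have : k = k / (1 - k * h) * (1 - k * h) := by field_simp
    rw [smul_sub, smul_smul, ← this]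
    abel
  rw [e3]
  refine (norm_add_le _ _).trans (add_le_add (hg t ⟨by linarith, le_rfl⟩) ?_)
  rw [norm_smul, Real.norm_of_nonneg (by positivity)]
  gcongr

/-- Exponential decay for `ė(t) = g(t) - k e(t - h)`, where `g` is bounded by `L` times the
supremum of `e` on `[t - δ, t]`, up to an exponentially decaying disturbance. -/
theorem exp_decay_of_delayed_feedback {E : Type*} [NormedAddCommGroup E]
    [NormedSpace ℝ E] {e g : ℝ → E} {k h L δ lam A W c₁ c₂ : ℝ} (hk : 0 < k) (hh : 0 < h)
    (hkh : k * h < 1) (hδ : 0 < δ) (hlam : 0 < lam) (he : Continuous e)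
    (he' : ∀ s, h ≤ s → HasDerivWithinAt e (g s - k • e (s - h)) (Ici s) s)
    (hg : ∀ s, h + δ ≤ s → ∀ M, (∀ r ∈ Icc (s - δ) s, ‖e r‖ ≤ M) →
      ‖g s‖ ≤ L * M + W * Real.exp (-lam * s))
    (hW : 0 ≤ W)
    (hdata : ∀ s ∈ Icc h (δ + 4 * h), ‖e s‖ ≤ A * Real.exp (-lam * s))
    (hc₁ : c₁ = L + k / (1 - k * h) * (h * (L + k * ((L + k) * h))))
    (hc₂ : c₂ = 1 + k / (1 - k * h) * (h * (1 + k * h)))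
    (hA : Real.exp (lam * (δ + 3 * h)) * (c₁ * A + c₂ * W) < (k / (1 - k * h) - lam) * A) :
    ∀ t, h ≤ t → ‖e t‖ ≤ A * Real.exp (-lam * t) := by
  set c := k / (1 - k * h) with hc
  have ha : 0 < 1 - k * h := by linarith
  -- The integrating factor exp(ct) removes the term -c e(t). The start δ + 4h guarantees that the
  -- look-back of length δ + 3h stays in t ≥ h, where the data and the past bound apply.
  have hmain := norm_le_of_norm_deriv_lt_of_past (a := δ + 4 * h)
    (y := fun t => Real.exp (c * t) • e t)
    (y' := fun t => Real.exp (c * t) • (g t - k • e (t - h)) + (Real.exp (c * t) * c) • e t)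
    (b := fun t => A * Real.exp ((c - lam) * t))
    (b' := fun t => A * (Real.exp ((c - lam) * t) * (c - lam))) (by fun_prop) (by fun_prop)
    (fun t ht => by
      have h1 : HasDerivAt (fun t => Real.exp (c * t)) (Real.exp (c * t) * c) t := by
        simpa using ((hasDerivAt_id t).const_mul c).exp
      exact h1.hasDerivWithinAt.smul (he' t (by linarith)))
    (fun t ht => by
      have h1 : HasDerivAt (fun t => Real.exp ((c - lam) * t))
        (Real.exp ((c - lam) * t) * (c - lam)) t := by
        simpa using ((hasDerivAt_id t).const_mul (c - lam)).exp
      exact h1.const_mul A)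
    (by
      have h1 := hdata (δ + 4 * h) ⟨by linarith, le_rfl⟩
      have h2 : (c - lam) * (δ + 4 * h) = c * (δ + 4 * h) + (-lam * (δ + 4 * h)) := by ring
      simp only [norm_smul, Real.norm_of_nonneg (Real.exp_pos _).le, h2, Real.exp_add]
      calc _ ≤ Real.exp (c * (δ + 4 * h)) * (A * Real.exp (-lam * (δ + 4 * h))) := by gcongr
        _ = _ := by ring)
    (fun t ht hpast => by
      have hA0 : 0 ≤ A := by
        have h1 := (norm_nonneg _).trans (hdata h ⟨le_rfl, by linarith⟩)
        exact nonneg_of_mul_nonneg_left h1 (Real.exp_pos _)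
      have hall : ∀ s ∈ Icc h t, ‖e s‖ ≤ A * Real.exp (-lam * s) := by
        intro s hs
        rcases le_total s (δ + 4 * h) with h1 | h1
        · exact hdata s ⟨hs.1, h1⟩
        · have h2 := hpast s ⟨h1, hs.2⟩
          have h3 : (c - lam) * s = c * s + (-lam * s) := by ring
          simp only [norm_smul, Real.norm_of_nonneg (Real.exp_pos _).le, h3, Real.exp_add] at h2
          have h4 : Real.exp (c * s) * ‖e s‖ ≤ Real.exp (c * s) * (A * Real.exp (-lam * s)) := by
            linarith
          exact le_of_mul_le_mul_left h4 (Real.exp_pos _)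
      -- The largest value of exp(-lam s) over the look-back: the estimate uses e on [t - 3h, t],
      -- and g on [t - 2h, t], which reaches back a further δ.
      set ρ := Real.exp (lam * (δ + 3 * h)) * Real.exp (-lam * t) with hρ
      have hexp : ∀ s, t - (δ + 3 * h) ≤ s → Real.exp (-lam * s) ≤ ρ := by
        intro s hs
        rw [hρ, ← Real.exp_add]
        apply Real.exp_le_exp.2
        nlinarith
      have hbd : ∀ s, t - (δ + 3 * h) ≤ s → s ≤ t → ‖e s‖ ≤ A * ρ := fun s hs hst =>
        (hall s ⟨by linarith, hst⟩).trans (by gcongr; exact hexp s hs)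
      have hkey := norm_deriv_add_smul_le_of_delayed_feedback (e := e) (g := g) (L := L)
        (M := A * ρ) (w := W * ρ) (t := t) hk hh hkh he
        (fun s hs => he' s (by linarith [hs.1]))
        (fun s hs => (hg s (by linarith [hs.1]) (A * ρ) (fun r hr =>
            hbd r (by linarith [hr.1, hs.1]) (by linarith [hr.2, hs.2]))).trans (by
              gcongr; exact hexp s (by linarith [hs.1])))
        (fun s hs => hbd s (by linarith [hs.1]) hs.2)
      rw [← hc] at hkey
      have e1 : Real.exp (c * t) • (g t - k • e (t - h)) + (Real.exp (c * t) * c) • e t =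
        Real.exp (c * t) • (g t - k • e (t - h) + c • e t) := by module
      have h3 : (c - lam) * t = c * t + (-lam * t) := by ring
      simp only [e1, norm_smul, Real.norm_of_nonneg (Real.exp_pos _).le, h3, Real.exp_add]
      have e2 : L * (A * ρ) + W * ρ +
          c * (h * (L * (A * ρ) + W * ρ + k * ((L * (A * ρ) + W * ρ + k * (A * ρ)) * h))) =
          (Real.exp (lam * (δ + 3 * h)) * (c₁ * A + c₂ * W)) * Real.exp (-lam * t) := by
        rw [hc₁, hc₂, hρ]; ring
      rw [e2] at hkey
      have h5 := mul_lt_mul_of_pos_right hA (Real.exp_pos (-lam * t))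
      have h6 := mul_lt_mul_of_pos_left (hkey.trans_lt h5) (Real.exp_pos (c * t))
      linarith)
  intro t ht
  rcases le_total t (δ + 4 * h) with h1 | h1
  · exact hdata t ⟨ht, h1⟩
  · have h2 := hmain t h1
    have h3 : (c - lam) * t = c * t + (-lam * t) := by ring
    simp only [norm_smul, Real.norm_of_nonneg (Real.exp_pos _).le, h3, Real.exp_add] at h2
    have h4 : Real.exp (c * t) * ‖e t‖ ≤ Real.exp (c * t) * (A * Real.exp (-lam * t)) := by
      linarith
    exact le_of_mul_le_mul_left h4 (Real.exp_pos _)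

/-- The gain margin behind `exp_decay_of_delayed_feedback`. -/
theorem delayed_feedback_gain_lt {L h : ℝ} (hL : 0 < L) (hh : 0 < h) (hLh : (L + 1) ^ 2 * h < 1) :
    (L + 1) * h < 1 ∧
      L + (L + 1) / (1 - (L + 1) * h) * (h * (L + (L + 1) * ((L + (L + 1)) * h))) <
        (L + 1) / (1 - (L + 1) * h) := by
  have h1 : (L + 1) * h < 1 := by nlinarith [mul_pos hL hh, mul_pos (mul_pos hL hL) hh]
  have ha : 0 < 1 - (L + 1) * h := by linarith
  refine ⟨h1, ?_⟩
  have hsq : ((L + 1) ^ 2 * h) ^ 2 < 1 := by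
    have : 0 < (L + 1) ^ 2 * h := by positivity
    nlinarith
  -- This is the gain condition after clearing the denominator 1 - (L + 1)h; it follows from 2L + 1
  -- ≤ (L + 1)².
  have hq : ((L + 1) * h) ^ 2 * (2 * L + 1) < 1 := by
    have h2 : ((L + 1) * h) ^ 2 * (2 * L + 1) ≤ ((L + 1) ^ 2 * h) ^ 2 := by
      have : ((L + 1) ^ 2 * h) ^ 2 = ((L + 1) * h) ^ 2 * (L + 1) ^ 2 := by ring
      rw [this]
      gcongr
      nlinarith
    linarith
  rw [div_mul_eq_mul_div, ← sub_pos]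
  have : (L + 1) / (1 - (L + 1) * h) -
      (L + (L + 1) * (h * (L + (L + 1) * ((L + (L + 1)) * h))) / (1 - (L + 1) * h)) =
      (1 - ((L + 1) * h) ^ 2 * (2 * L + 1)) / (1 - (L + 1) * h) := by
    field_simp
    ring
  rw [this]
  exact div_pos (by linarith) ha

/-! ### Norms of history segments -/

section HistorySegment

variable {E : Type*} [NormedAddCommGroup E] {δ : ℝ}

theorem continuous_historySegment (δ : ℝ) (x : C(ℝ, E)) :
    Continuous fun t => historySegment δ x t := by
  refine ContinuousMap.continuous_of_continuous_uncurry _ ?_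
  change Continuous fun q : ℝ × Icc (-δ) (0 : ℝ) => x (q.1 + q.2)
  fun_prop

/-- The two base times are independent because a predictor at time t - h is compared with its
predecessor at time t. -/
theorem norm_historySegment_sub_le (hδ : 0 < δ) {x y : C(ℝ, E)} {t s M : ℝ}
    (h : ∀ θ ∈ Icc (-δ) (0 : ℝ), ‖x (t + θ) - y (s + θ)‖ ≤ M) :
    ‖historySegment δ x t - historySegment δ y s‖ ≤ M := by
  have : Nonempty (Icc (-δ) (0 : ℝ)) := ⟨⟨0, by constructor <;> linarith⟩⟩
  exact (ContinuousMap.norm_le_of_nonempty _).2 fun θ => h θ θ.2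

theorem norm_historySegment_le (hδ : 0 < δ) {x : C(ℝ, E)} {t M : ℝ}
    (h : ∀ s ∈ Icc (t - δ) t, ‖x s‖ ≤ M) : ‖historySegment δ x t‖ ≤ M := by
  have : Nonempty (Icc (-δ) (0 : ℝ)) := ⟨⟨0, by constructor <;> linarith⟩⟩
  exact (ContinuousMap.norm_le_of_nonempty _).2 fun θ =>
    h _ ⟨by linarith [θ.2.1], by linarith [θ.2.2]⟩

end HistorySegment

/-! ### Existence and exponential growth bounds for the closed loop -/

section Existence

variable {n p : ℕ} {δ d L : ℝ} {m : ℕ}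
  {f : C(Set.Icc (-δ) (0 : ℝ), EuclideanSpace ℝ (Fin n)) →
      EuclideanSpace ℝ (Fin p) → EuclideanSpace ℝ (Fin n)}
  {α : EuclideanSpace ℝ (Fin n) → EuclideanSpace ℝ (Fin p)}

theorem continuous_uncurry_of_lipschitz (hL : 0 < L)
    (hf : ∀ φ φ' u u', ‖f φ u - f φ' u'‖ ≤ L * (‖φ - φ'‖ + ‖u - u'‖)) :
    Continuous (Function.uncurry f) := by
  refine (LipschitzWith.of_dist_le_mul (K := ⟨2 * L, by positivity⟩) fun q q' => ?_).continuous
  rw [dist_eq_norm, dist_eq_norm]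
  refine (hf q.1 q'.1 q.2 q'.2).trans ?_
  have h1 : ‖q.1 - q'.1‖ ≤ ‖q - q'‖ := norm_fst_le (q - q')
  have h2 : ‖q.2 - q'.2‖ ≤ ‖q - q'‖ := norm_snd_le (q - q')
  change _ ≤ 2 * L * _
  nlinarith

/-- Stability of the delay-free system only speaks about given solutions. Existence supplies the
reference solution with which the perturbed plant is compared on each period. -/
theorem exists_isDelayFreeSolution (hδ : 0 < δ) (hL : 0 < L) (hf0 : f 0 0 = 0)
    (hf : ∀ φ φ' u u', ‖f φ u - f φ' u'‖ ≤ L * (‖φ - φ'‖ + ‖u - u'‖))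
    (hα0 : α 0 = 0) {K : NNReal} (hα : LipschitzWith K α)
    (ψ : C(Set.Icc (-δ) (0 : ℝ), EuclideanSpace ℝ (Fin n))) :
    ∃ x, IsDelayFreeSolution δ f α ψ x := by
  have hδ0 : -δ ≤ 0 := by linarith
  have hfc := continuous_uncurry_of_lipschitz hL hf
  have hFc : ∀ x : C(ℝ, EuclideanSpace ℝ (Fin n)),
      Continuous fun t => f (historySegment δ x t) (α (x t)) := fun x =>
    hfc.comp ((continuous_historySegment δ x).prodMk (hα.continuous.comp x.continuous))
  obtain ⟨x, hx0, hx⟩ := exists_solution_of_causal_lipschitz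
    (fun (x : C(ℝ, EuclideanSpace ℝ (Fin n))) t => f (historySegment δ x t) (α (x t)))
    (K := L * (1 + K)) (C := 0) (M := ‖ψ‖) (by positivity)
    (fun x x' t _ R hR => by
      refine (hf _ _ _ _).trans ?_
      rw [mul_assoc]
      have h1 : ‖historySegment δ x t - historySegment δ x' t‖ ≤ R :=
        norm_historySegment_sub_le hδ fun θ hθ => hR _ (by linarith [hθ.2])
      have h2 : ‖α (x t) - α (x' t)‖ ≤ K * R :=
        (hα.norm_sub_le _ _).trans (by gcongr; exact hR t le_rfl)
      rw [one_add_mul]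
      gcongr)
    (fun x t _ => (hFc x).continuousWithinAt)
    (fun x => (hFc x).stronglyMeasurable)
    (fun t _ => by
      have : historySegment δ (0 : C(ℝ, EuclideanSpace ℝ (Fin n))) t = 0 := rfl
      simp [this, hα0, hf0])
    ⟨IccExtend hδ0 ψ, ψ.continuous.Icc_extend'⟩
    (fun t => ψ.norm_coe_le_norm _)
    (fun t ht => by
      change IccExtend hδ0 ψ t = IccExtend hδ0 ψ 0
      rw [IccExtend_of_right_le _ _ ht, IccExtend_of_right_le _ _ le_rfl])
  refine ⟨x, fun θ => ?_, hx⟩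
  rw [hx0 _ θ.2.2]
  exact IccExtend_val hδ0 ψ θ

/-- The input of the closed loop: `υ` before time `0`, the feedback afterwards. -/
noncomputable def closedLoopInput (hd : -d ≤ 0)
    (α : EuclideanSpace ℝ (Fin n) → EuclideanSpace ℝ (Fin p))
    (υ : C(Set.Icc (-d) (0 : ℝ), EuclideanSpace ℝ (Fin p)))
    (x : C(ℝ, EuclideanSpace ℝ (Fin n))) (t : ℝ) : EuclideanSpace ℝ (Fin p) :=
  if t < 0 then IccExtend hd υ t else α (x t)

theorem stronglyMeasurable_closedLoopInput (hd : -d ≤ 0) (hα : Continuous α)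
    (υ : C(Set.Icc (-d) (0 : ℝ), EuclideanSpace ℝ (Fin p)))
    (x : C(ℝ, EuclideanSpace ℝ (Fin n))) :
    MeasureTheory.StronglyMeasurable (closedLoopInput hd α υ x) :=
  MeasureTheory.StronglyMeasurable.ite measurableSet_Iio
    υ.continuous.Icc_extend'.stronglyMeasurable (hα.comp x.continuous).stronglyMeasurable

/-- The jump at 0 is harmless because the feedback branch includes t = 0, so the input agrees with a
continuous function to the right of every point. -/
theorem continuousWithinAt_closedLoopInput (hd : -d ≤ 0) (hα : Continuous α)
    (υ : C(Set.Icc (-d) (0 : ℝ), EuclideanSpace ℝ (Fin p)))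
    (x : C(ℝ, EuclideanSpace ℝ (Fin n))) (t : ℝ) :
    ContinuousWithinAt (closedLoopInput hd α υ x) (Ici t) t := by
  rcases lt_or_ge t 0 with ht | ht
  · have h1 : ContinuousAt (IccExtend hd υ) t := υ.continuous.Icc_extend'.continuousAt
    refine (h1.congr ?_).continuousWithinAt
    filter_upwards [Iio_mem_nhds ht] with s hs
    exact (if_pos hs).symm
  · have h1 : ContinuousWithinAt (fun s => α (x s)) (Ici t) t :=
      (hα.comp x.continuous).continuousWithinAt
    exact h1.congr (fun s hs => if_neg (not_lt.2 (ht.trans hs))) (if_neg (not_lt.2 ht))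

theorem norm_closedLoopInput_sub_le (hd : -d ≤ 0) {K : NNReal} (hα : LipschitzWith K α)
    (υ : C(Set.Icc (-d) (0 : ℝ), EuclideanSpace ℝ (Fin p)))
    {x x' : C(ℝ, EuclideanSpace ℝ (Fin n))} {t R : ℝ} (hR : ‖x t - x' t‖ ≤ R) :
    ‖closedLoopInput hd α υ x t - closedLoopInput hd α υ x' t‖ ≤ K * R := by
  unfold closedLoopInput
  split_ifs
  · simpa using mul_nonneg K.2 ((norm_nonneg _).trans hR)
  · exact (hα.norm_sub_le _ _).trans (by gcongr)

theorem norm_closedLoopInput_zero_le (hd : -d ≤ 0) (hα0 : α 0 = 0)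
    (υ : C(Set.Icc (-d) (0 : ℝ), EuclideanSpace ℝ (Fin p))) (t : ℝ) :
    ‖closedLoopInput hd α υ 0 t‖ ≤ ‖υ‖ := by
  unfold closedLoopInput
  split_ifs
  · exact υ.norm_coe_le_norm _
  · simp [hα0]

/-- The component `z_i` of a path of tuples. -/
def trajectoryComponent (Y : C(ℝ, Fin (m + 1) → EuclideanSpace ℝ (Fin n))) (i : Fin (m + 1)) :
    C(ℝ, EuclideanSpace ℝ (Fin n)) :=
  ⟨fun t => Y t i, by fun_prop⟩

/-- The right-hand side of the closed loop, as a functional of the whole trajectory. -/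
noncomputable def closedLoopField (hd : -d ≤ 0) (L : ℝ)
    (f : C(Set.Icc (-δ) (0 : ℝ), EuclideanSpace ℝ (Fin n)) →
      EuclideanSpace ℝ (Fin p) → EuclideanSpace ℝ (Fin n))
    (α : EuclideanSpace ℝ (Fin n) → EuclideanSpace ℝ (Fin p))
    (υ : C(Set.Icc (-d) (0 : ℝ), EuclideanSpace ℝ (Fin p)))
    (Y : C(ℝ, Fin (m + 1) → EuclideanSpace ℝ (Fin n))) (t : ℝ) :
    Fin (m + 1) → EuclideanSpace ℝ (Fin n) :=
  Fin.cons
    (f (historySegment δ (trajectoryComponent Y 0) t)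
      (closedLoopInput hd α υ (trajectoryComponent Y (Fin.last m)) (t - d)))
    (fun i : Fin m => f (historySegment δ (trajectoryComponent Y i.succ) t)
        (closedLoopInput hd α υ (trajectoryComponent Y (Fin.last m)) (t - d + ((i : ℝ) + 1) * d / m))
      - (L + 1) • (trajectoryComponent Y i.succ (t - d / m) - trajectoryComponent Y i.castSucc t))

theorem closedLoopField_zero (hd : -d ≤ 0)
    (υ : C(Set.Icc (-d) (0 : ℝ), EuclideanSpace ℝ (Fin p)))
    (Y : C(ℝ, Fin (m + 1) → EuclideanSpace ℝ (Fin n))) (t : ℝ) :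
    closedLoopField hd L f α υ Y t 0 = f (historySegment δ (trajectoryComponent Y 0) t)
      (closedLoopInput hd α υ (trajectoryComponent Y (Fin.last m)) (t - d)) := by
  rw [closedLoopField, Fin.cons_zero]

theorem closedLoopField_succ (hd : -d ≤ 0)
    (υ : C(Set.Icc (-d) (0 : ℝ), EuclideanSpace ℝ (Fin p)))
    (Y : C(ℝ, Fin (m + 1) → EuclideanSpace ℝ (Fin n))) (t : ℝ) (i : Fin m) :
    closedLoopField hd L f α υ Y t i.succ = f (historySegment δ (trajectoryComponent Y i.succ) t)
        (closedLoopInput hd α υ (trajectoryComponent Y (Fin.last m)) (t - d + ((i : ℝ) + 1) * d / m))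
      - (L + 1) • (trajectoryComponent Y i.succ (t - d / m) - trajectoryComponent Y i.castSucc t) := by
  rw [closedLoopField, Fin.cons_succ]

/-- Causality: no predictor uses an input value later than the current time. -/
theorem predictor_input_shift_le (hd : 0 < d) (i : Fin m) : ((i : ℝ) + 1) * d / m ≤ d := by
  have hm : (0 : ℝ) < m := by exact_mod_cast i.pos
  rw [div_le_iff₀ hm, mul_comm d]
  gcongr
  exact_mod_cast i.2

theorem norm_closedLoopField_sub_le (hδ : 0 < δ) (hd : 0 < d) (hd0 : -d ≤ 0) (hL : 0 < L)
    (hf : ∀ φ φ' u u', ‖f φ u - f φ' u'‖ ≤ L * (‖φ - φ'‖ + ‖u - u'‖))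
    {K : NNReal} (hα : LipschitzWith K α)
    (υ : C(Set.Icc (-d) (0 : ℝ), EuclideanSpace ℝ (Fin p)))
    (Y Y' : C(ℝ, Fin (m + 1) → EuclideanSpace ℝ (Fin n))) (t R : ℝ)
    (hR : ∀ s ≤ t, ‖Y s - Y' s‖ ≤ R) :
    ‖closedLoopField hd0 L f α υ Y t - closedLoopField hd0 L f α υ Y' t‖ ≤
      (L * (1 + K) + 2 * (L + 1)) * R := by
  have hR0 : 0 ≤ R := (norm_nonneg _).trans (hR t le_rfl)
  have hpr : ∀ s ≤ t, ∀ i, ‖trajectoryComponent Y i s - trajectoryComponent Y' i s‖ ≤ R := fun s hs i =>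
    (norm_le_pi_norm (Y s - Y' s) i).trans (hR s hs)
  have hfU : ∀ s ≤ t, ∀ i,
      ‖f (historySegment δ (trajectoryComponent Y i) t)
          (closedLoopInput hd0 α υ (trajectoryComponent Y (Fin.last m)) s) -
        f (historySegment δ (trajectoryComponent Y' i) t)
          (closedLoopInput hd0 α υ (trajectoryComponent Y' (Fin.last m)) s)‖ ≤ L * (R + K * R) := by
    intro s hs i
    refine (hf _ _ _ _).trans ?_
    gcongr
    · exact norm_historySegment_sub_le hδ fun θ hθ => hpr _ (by linarith [hθ.2]) i
    · exact norm_closedLoopInput_sub_le hd0 hα υ (hpr s hs _)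
  refine (pi_norm_le_iff_of_nonneg (by positivity)).2 fun i => ?_
  rw [Pi.sub_apply]
  induction i using Fin.cases with
  | zero =>
    rw [closedLoopField_zero, closedLoopField_zero]
    refine (hfU (t - d) (by linarith) 0).trans ?_
    have : 0 ≤ (L + 1) * R := by positivity
    linarith
  | succ i =>
    rw [closedLoopField_succ, closedLoopField_succ]
    have hdm : 0 ≤ d / m := by positivity
    have h1 := hfU (t - d + ((i : ℝ) + 1) * d / m)
      (by linarith [predictor_input_shift_le hd i]) i.succ
    have h2 := hpr (t - d / m) (by linarith) i.succ
    have h3 := hpr t le_rfl i.castSucc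
    have e1 : ∀ a b c a' b' c' : EuclideanSpace ℝ (Fin n),
        (a - (L + 1) • (b - c)) - (a' - (L + 1) • (b' - c')) =
        (a - a') - (L + 1) • ((b - b') - (c - c')) := by intros; module
    rw [e1]
    refine (norm_sub_le _ _).trans ?_
    rw [norm_smul, Real.norm_of_nonneg (by positivity)]
    have h4 := (norm_sub_le _ _).trans (add_le_add h2 h3)
    calc _ ≤ L * (R + K * R) + (L + 1) * (R + R) := by gcongr
      _ = _ := by ring

theorem continuousWithinAt_closedLoopField (hd0 : -d ≤ 0) (hfc : Continuous (Function.uncurry f))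
    (hα : Continuous α) (υ : C(Set.Icc (-d) (0 : ℝ), EuclideanSpace ℝ (Fin p)))
    (Y : C(ℝ, Fin (m + 1) → EuclideanSpace ℝ (Fin n))) (t : ℝ) :
    ContinuousWithinAt (closedLoopField hd0 L f α υ Y) (Ici t) t := by
  have hcw : ∀ (i : Fin (m + 1)) (a : ℝ), ContinuousWithinAt
      (fun t => f (historySegment δ (trajectoryComponent Y i) t)
        (closedLoopInput hd0 α υ (trajectoryComponent Y (Fin.last m)) (t + a))) (Ici t) t := fun i a =>
    hfc.continuousAt.comp_continuousWithinAt
      (f := fun t => (historySegment δ (trajectoryComponent Y i) t,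
        closedLoopInput hd0 α υ (trajectoryComponent Y (Fin.last m)) (t + a)))
      ((continuous_historySegment δ _).continuousWithinAt.prodMk
        ((continuousWithinAt_closedLoopInput hd0 hα υ _ (t + a)).comp (f := fun s => s + a)
          (x := t) (s := Ici t) (Continuous.continuousWithinAt (by fun_prop))
          (fun s hs => by simpa using hs)))
  refine continuousWithinAt_pi.2 fun i => ?_
  induction i using Fin.cases with
  | zero =>
    simp only [closedLoopField_zero]
    simpa only [← sub_eq_add_neg] using hcw 0 (-d)
  | succ i =>
    simp only [closedLoopField_succ]
    refine ContinuousWithinAt.sub ?_ (Continuous.continuousWithinAt (by fun_prop))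
    have := hcw i.succ (-d + ((i : ℝ) + 1) * d / m)
    simpa only [← add_assoc, ← sub_eq_add_neg] using this

theorem stronglyMeasurable_closedLoopField (hd0 : -d ≤ 0) (hfc : Continuous (Function.uncurry f))
    (hα : Continuous α) (υ : C(Set.Icc (-d) (0 : ℝ), EuclideanSpace ℝ (Fin p)))
    (Y : C(ℝ, Fin (m + 1) → EuclideanSpace ℝ (Fin n))) :
    MeasureTheory.StronglyMeasurable (closedLoopField hd0 L f α υ Y) := by
  have hsm : ∀ (i : Fin (m + 1)) (a : ℝ), MeasureTheory.StronglyMeasurable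
      fun t => f (historySegment δ (trajectoryComponent Y i) t)
        (closedLoopInput hd0 α υ (trajectoryComponent Y (Fin.last m)) (t + a)) := fun i a =>
    hfc.comp_stronglyMeasurable ((continuous_historySegment δ _).stronglyMeasurable.prodMk
      ((stronglyMeasurable_closedLoopInput hd0 hα υ _).comp_measurable
        (measurable_id.add_const a)))
  refine (measurable_pi_iff.2 fun i => ?_).stronglyMeasurable
  induction i using Fin.cases with
  | zero =>
    simp only [closedLoopField_zero]
    simpa only [← sub_eq_add_neg] using (hsm 0 (-d)).measurable
  | succ i =>
    simp only [closedLoopField_succ]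
    refine Measurable.sub ?_ (Continuous.measurable (by fun_prop))
    have := (hsm i.succ (-d + ((i : ℝ) + 1) * d / m)).measurable
    simpa only [← add_assoc, ← sub_eq_add_neg] using this

theorem norm_closedLoopField_zero_path_le (hd0 : -d ≤ 0) (hL : 0 < L) (hf0 : f 0 0 = 0)
    (hf : ∀ φ φ' u u', ‖f φ u - f φ' u'‖ ≤ L * (‖φ - φ'‖ + ‖u - u'‖))
    (hα0 : α 0 = 0) (υ : C(Set.Icc (-d) (0 : ℝ), EuclideanSpace ℝ (Fin p))) (t : ℝ) :
    ‖closedLoopField hd0 L f α υ (0 : C(ℝ, Fin (m + 1) → EuclideanSpace ℝ (Fin n))) t‖ ≤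
      L * ‖υ‖ := by
  have hp : ∀ i, trajectoryComponent (0 : C(ℝ, Fin (m + 1) → EuclideanSpace ℝ (Fin n))) i = 0 :=
    fun _ => rfl
  have hs : historySegment δ (0 : C(ℝ, EuclideanSpace ℝ (Fin n))) t = 0 := rfl
  have hu : ∀ s, ‖f 0 (closedLoopInput hd0 α υ 0 s)‖ ≤ L * ‖υ‖ := by
    intro s
    have := hf 0 0 (closedLoopInput hd0 α υ 0 s) 0
    rw [hf0, sub_zero, sub_zero, sub_zero, norm_zero, zero_add] at this
    exact this.trans (by gcongr; exact norm_closedLoopInput_zero_le hd0 hα0 υ s)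
  refine (pi_norm_le_iff_of_nonneg (by positivity)).2 fun i => ?_
  induction i using Fin.cases with
  | zero =>
    rw [closedLoopField_zero, hp, hp, hs]
    exact hu _
  | succ i =>
    rw [closedLoopField_succ, hp, hp, hp, hs, ContinuousMap.zero_apply, ContinuousMap.zero_apply,
      sub_zero, smul_zero, sub_zero]
    exact hu _

theorem exists_isClosedLoopSolution (hδ : 0 < δ) (hd : 0 < d) (hL : 0 < L) (hf0 : f 0 0 = 0)
    (hf : ∀ φ φ' u u', ‖f φ u - f φ' u'‖ ≤ L * (‖φ - φ'‖ + ‖u - u'‖))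
    (hα0 : α 0 = 0) {K : NNReal} (hα : LipschitzWith K α)
    (ψ : C(Set.Icc (-δ) (0 : ℝ), EuclideanSpace ℝ (Fin n)))
    (φ : Fin m → C(Set.Icc (-(max δ (d / m))) (0 : ℝ), EuclideanSpace ℝ (Fin n)))
    (υ : C(Set.Icc (-d) (0 : ℝ), EuclideanSpace ℝ (Fin p))) :
    ∃ z u, IsClosedLoopSolution δ d L m f α ψ φ υ z u := by
  have hδ0 : -δ ≤ 0 := by linarith
  have hd0 : -d ≤ 0 := by linarith
  have hδ0' : -(max δ (d / m)) ≤ 0 := by linarith [le_max_left δ (d / m)]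
  have hfc := continuous_uncurry_of_lipschitz hL hf
  obtain ⟨Y₀, hY₀0, hY₀s⟩ : ∃ Y₀ : C(ℝ, Fin (m + 1) → EuclideanSpace ℝ (Fin n)),
      (∀ t, Y₀ t 0 = IccExtend hδ0 ψ t) ∧ ∀ t i, Y₀ t (Fin.succ i) = IccExtend hδ0' (φ i) t := by
    refine ⟨⟨fun t => Fin.cons (IccExtend hδ0 ψ t) (fun i => IccExtend hδ0' (φ i) t), ?_⟩,
      fun _ => rfl, fun _ _ => rfl⟩
    refine continuous_pi fun i => ?_
    induction i using Fin.cases with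
    | zero => simpa only [Fin.cons_zero] using ψ.continuous.Icc_extend'
    | succ i => simpa only [Fin.cons_succ] using (φ i).continuous.Icc_extend'
  obtain ⟨Y, hY0, hY⟩ := exists_solution_of_causal_lipschitz
    (closedLoopField hd0 L f α υ) (K := L * (1 + K) + 2 * (L + 1)) (C := L * ‖υ‖)
    (M := max ‖ψ‖ ‖φ‖) (by positivity)
    (fun Y Y' t _ R hR => norm_closedLoopField_sub_le hδ hd hd0 hL hf hα υ Y Y' t R hR)
    (fun Y t _ => continuousWithinAt_closedLoopField hd0 hfc hα.continuous υ Y t)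
    (fun Y => stronglyMeasurable_closedLoopField hd0 hfc hα.continuous υ Y)
    (fun t _ => norm_closedLoopField_zero_path_le hd0 hL hf0 hf hα0 υ t) Y₀
    (fun t => by
      refine (pi_norm_le_iff_of_nonneg (by positivity)).2 fun i => ?_
      induction i using Fin.cases with
      | zero =>
        rw [hY₀0]
        exact (ψ.norm_coe_le_norm _).trans (le_max_left _ _)
      | succ i =>
        rw [hY₀s]
        exact ((φ i).norm_coe_le_norm _).trans ((norm_le_pi_norm φ i).trans (le_max_right _ _)))
    (fun t ht => by
      refine funext fun i => ?_
      induction i using Fin.cases with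
      | zero =>
        rw [hY₀0, hY₀0, IccExtend_of_right_le _ _ ht, IccExtend_of_right_le _ _ le_rfl]
      | succ i =>
        rw [hY₀s, hY₀s, IccExtend_of_right_le _ _ ht, IccExtend_of_right_le _ _ le_rfl])
  refine ⟨trajectoryComponent Y, closedLoopInput hd0 α υ (trajectoryComponent Y (Fin.last m)),
    ⟨fun θ => ?_, fun i θ => ?_, fun θ hθ => ?_, fun t ht => ?_, fun t ht => ?_, fun i t ht => ?_⟩⟩
  · change Y θ 0 = _
    rw [hY0 _ θ.2.2, hY₀0]
    exact IccExtend_val hδ0 ψ θ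
  · change Y θ i.succ = _
    rw [hY0 _ θ.2.2, hY₀s]
    exact IccExtend_val hδ0' (φ i) θ
  · exact (if_pos hθ).trans (IccExtend_val hd0 υ θ)
  · exact if_neg (not_lt.2 ht)
  · rw [← closedLoopField_zero (L := L) (f := f)]
    exact hasDerivWithinAt_pi.1 (hY t ht) 0
  · rw [← closedLoopField_succ (f := f)]
    exact hasDerivWithinAt_pi.1 (hY t ht) i.succ

/-- Solutions of the closed loop grow at most exponentially. -/
theorem IsClosedLoopSolution.norm_le_exp (hδ : 0 < δ) (hd : 0 < d) (hL : 0 < L) (hf0 : f 0 0 = 0)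
    (hf : ∀ φ φ' u u', ‖f φ u - f φ' u'‖ ≤ L * (‖φ - φ'‖ + ‖u - u'‖))
    (hα0 : α 0 = 0) {K : NNReal} (hα : LipschitzWith K α) (hm : 0 < m)
    {ψ : C(Set.Icc (-δ) (0 : ℝ), EuclideanSpace ℝ (Fin n))}
    {φ : Fin m → C(Set.Icc (-(max δ (d / m))) (0 : ℝ), EuclideanSpace ℝ (Fin n))}
    {υ : C(Set.Icc (-d) (0 : ℝ), EuclideanSpace ℝ (Fin p))}
    {z : Fin (m + 1) → C(ℝ, EuclideanSpace ℝ (Fin n))} {u : ℝ → EuclideanSpace ℝ (Fin p)}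
    (hz : IsClosedLoopSolution δ d L m f α ψ φ υ z u) {S : ℝ} (hS : 0 < S)
    (hdata : ‖(ψ, φ, υ)‖ ≤ S) {t : ℝ} (ht : 0 ≤ t) (i : Fin (m + 1)) :
    ‖z i t‖ ≤ S * Real.exp ((L * (2 + K) + 2 * (L + 1) + 1) * t) := by
  have hm' : (0 : ℝ) < m := by exact_mod_cast hm
  have hdm : 0 < d / m := by positivity
  have hψ : ‖ψ‖ ≤ S := (norm_fst_le (ψ, φ, υ)).trans hdata
  have hφυ : ‖(φ, υ)‖ ≤ S := (norm_snd_le (ψ, φ, υ)).trans hdata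
  have hφ : ∀ i, ‖φ i‖ ≤ S := fun i =>
    (norm_le_pi_norm φ i).trans ((norm_fst_le (φ, υ)).trans hφυ)
  have hυ : ‖υ‖ ≤ S := (norm_snd_le (φ, υ)).trans hφυ
  -- If states and data are at most b, the input is at most (1 + K)b, so f contributes L(2 + K)b and
  -- the correction 2(L + 1)b. The extra 1 makes the barrier inequality strict.
  set κ : ℝ := L * (2 + K) + 2 * (L + 1) + 1 with hκ
  have hκ0 : 0 < κ := by positivity
  have hmain := norm_le_of_norm_deriv_lt_of_past (a := 0) (y := fun t i => z i t)
    (y' := fun t => Fin.cons (f (historySegment δ (z 0) t) (u (t - d)))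
      (fun i : Fin m => f (historySegment δ (z i.succ) t) (u (t - d + ((i : ℝ) + 1) * d / m))
        - (L + 1) • (z i.succ (t - d / m) - z i.castSucc t)))
    (b := fun t => S * Real.exp (κ * t)) (b' := fun t => S * (Real.exp (κ * t) * κ))
    (by fun_prop) (by fun_prop)
    (fun t ht => by
      refine hasDerivWithinAt_pi.2 fun i => ?_
      refine Fin.cases ?_ (fun i => ?_) i
      · exact hz.plant t ht
      · exact hz.predictor i t ht)
    (fun t ht => by
      have h1 : HasDerivAt (fun t => Real.exp (κ * t)) (Real.exp (κ * t) * κ) t := by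
        simpa using ((hasDerivAt_id t).const_mul κ).exp
      exact h1.const_mul S)
    (by
      rw [mul_zero, Real.exp_zero, mul_one]
      refine (pi_norm_le_iff_of_nonneg hS.le).2 fun i => ?_
      refine Fin.cases ?_ (fun i => ?_) i
      · have := hz.init_plant ⟨0, by constructor <;> linarith⟩
        change ‖z 0 (0 : ℝ)‖ ≤ S
        rw [this]
        exact (ψ.norm_coe_le_norm _).trans hψ
      · have := hz.init_predictor i ⟨0, by constructor <;> linarith [le_max_left δ (d / m)]⟩
        change ‖z i.succ (0 : ℝ)‖ ≤ S
        rw [this]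
        exact ((φ i).norm_coe_le_norm _).trans (hφ i))
    (fun t ht hpast => by
      set b := S * Real.exp (κ * t) with hb
      have hSb : S ≤ b := le_mul_of_one_le_right hS.le (Real.one_le_exp (by positivity))
      have hb0 : 0 < b := hS.trans_le hSb
      have hnn : ∀ s, 0 ≤ s → s ≤ t → ∀ i, ‖z i s‖ ≤ b := by
        intro s hs hst i
        refine (norm_le_pi_norm (fun i => z i s) i).trans ((hpast s ⟨hs, hst⟩).trans ?_)
        rw [hb]
        gcongr
      have h0 : ∀ s, -δ ≤ s → s ≤ t → ‖z 0 s‖ ≤ b := by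
        intro s hs hst
        rcases le_total 0 s with h | h
        · exact hnn s h hst 0
        · rw [hz.init_plant ⟨s, hs, h⟩]
          exact (ψ.norm_coe_le_norm _).trans (hψ.trans hSb)
      have h1 : ∀ (i : Fin m) s, -(max δ (d / m)) ≤ s → s ≤ t → ‖z i.succ s‖ ≤ b := by
        intro i s hs hst
        rcases le_total 0 s with h | h
        · exact hnn s h hst _
        · rw [hz.init_predictor i ⟨s, hs, h⟩]
          exact ((φ i).norm_coe_le_norm _).trans ((hφ i).trans hSb)
      have hu : ∀ s, -d ≤ s → s ≤ t → ‖u s‖ ≤ (1 + K) * b := by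
        intro s hs hst
        rcases le_or_gt 0 s with h | h
        · rw [hz.feedback s h]
          have h2 := hα.norm_sub_le (z (Fin.last m) s) 0
          rw [hα0, sub_zero, sub_zero] at h2
          have h3 : (K : ℝ) * ‖z (Fin.last m) s‖ ≤ K * b := by
            gcongr
            exact hnn s h hst _
          linarith
        · rw [hz.init_input ⟨s, hs, h.le⟩ h]
          have h2 : ‖υ ⟨s, hs, h.le⟩‖ ≤ b := (υ.norm_coe_le_norm _).trans (hυ.trans hSb)
          have h3 : 0 ≤ (K : ℝ) * b := by positivity
          linarith
      have hfle : ∀ (x : C(ℝ, EuclideanSpace ℝ (Fin n))) s, -d ≤ s → s ≤ t →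
          (∀ r ∈ Icc (t - δ) t, ‖x r‖ ≤ b) →
          ‖f (historySegment δ x t) (u s)‖ ≤ L * (2 + K) * b := by
        intro x s hs hst hx
        have h2 := hf (historySegment δ x t) 0 (u s) 0
        rw [hf0, sub_zero, sub_zero, sub_zero] at h2
        calc _ ≤ L * (b + (1 + K) * b) := h2.trans (by
              gcongr
              · exact norm_historySegment_le hδ hx
              · exact hu s hs hst)
          _ = _ := by ring
      have hrhs : S * (Real.exp (κ * t) * κ) = κ * b := by rw [hb]; ring
      rw [hrhs]
      refine (pi_norm_lt_iff (by positivity)).2 fun i => ?_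
      refine Fin.cases ?_ (fun i => ?_) i
      · refine (hfle (z 0) (t - d) (by linarith) (by linarith)
          (fun r hr => h0 r (by linarith [hr.1]) hr.2)).trans_lt ?_
        rw [hκ]
        gcongr
        linarith
      · have hi0 : 0 ≤ ((i : ℝ) + 1) * d / m := by positivity
        have hi1 := predictor_input_shift_le hd i
        have h2 := hfle (z i.succ) (t - d + ((i : ℝ) + 1) * d / m) (by linarith) (by linarith)
          (fun r hr => h1 i r (by linarith [hr.1, le_max_left δ (d / m)]) hr.2)
        have h3 := h1 i (t - d / m) (by linarith [le_max_right δ (d / m)]) (by linarith)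
        have h4 := hnn t ht le_rfl i.castSucc
        have h5 := (norm_sub_le (z i.succ (t - d / m)) (z i.castSucc t)).trans (add_le_add h3 h4)
        change ‖f (historySegment δ (z i.succ) t) (u (t - d + ((i : ℝ) + 1) * d / m))
          - (L + 1) • (z i.succ (t - d / m) - z i.castSucc t)‖ < _
        refine (norm_sub_le _ _).trans_lt ?_
        rw [norm_smul, Real.norm_of_nonneg (by positivity)]
        calc _ ≤ L * (2 + K) * b + (L + 1) * (b + b) := by gcongr
          _ < κ * b := by rw [hκ]; linarith)
  exact (norm_le_pi_norm (fun i => z i t) i).trans (hmain t ht)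

end Existence

theorem HasDerivWithinAt.comp_add_const_Ici {E : Type*} [NormedAddCommGroup E] [NormedSpace ℝ E]
    {x : ℝ → E} {x' : E} {t : ℝ} (a : ℝ) (hx : HasDerivWithinAt x x' (Ici (t + a)) (t + a)) :
    HasDerivWithinAt (fun s => x (s + a)) x' (Ici t) t := by
  have h1 : HasDerivWithinAt (fun s : ℝ => s + a) 1 (Ici t) t :=
    (hasDerivWithinAt_id t _).add_const a
  simpa [Function.comp_def] using HasDerivWithinAt.scomp t hx h1 (fun s hs => by simpa using hs)

/-! ### Robustness of the delay-free plant -/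

section Plant

variable {n p : ℕ} {δ L : ℝ}
  {f : C(Set.Icc (-δ) (0 : ℝ), EuclideanSpace ℝ (Fin n)) →
      EuclideanSpace ℝ (Fin p) → EuclideanSpace ℝ (Fin n)}
  {α : EuclideanSpace ℝ (Fin n) → EuclideanSpace ℝ (Fin p)}

/-- Distance of a solution with perturbed feedback from the unperturbed one with the same
history. -/
theorem norm_perturbed_sub_delayFree_le (hδ : 0 < δ) (hL : 0 < L)
    (hf : ∀ φ φ' u u', ‖f φ u - f φ' u'‖ ≤ L * (‖φ - φ'‖ + ‖u - u'‖))
    {K : NNReal} (hα : LipschitzWith K α) {x ξ : C(ℝ, EuclideanSpace ℝ (Fin n))}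
    {v : ℝ → EuclideanSpace ℝ (Fin n)} {t₀ η : ℝ} (hη : 0 < η)
    (hx : ∀ t, t₀ ≤ t → HasDerivWithinAt x (f (historySegment δ x t) (α (x t + v t))) (Ici t) t)
    (hv : ∀ t, t₀ ≤ t → ‖v t‖ ≤ η)
    (hξ : IsDelayFreeSolution δ f α (historySegment δ x t₀) ξ) {s : ℝ} (hs : 0 ≤ s) :
    ‖x (s + t₀) - ξ s‖ ≤ η * Real.exp ((L * (1 + 2 * K) + 1) * s) := by
  set κ : ℝ := L * (1 + 2 * K) + 1 with hκ
  have hκ0 : 0 < κ := by positivity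
  have hhist : ∀ θ ∈ Icc (-δ) (0 : ℝ), x (θ + t₀) - ξ θ = 0 := by
    intro θ hθ
    rw [hξ.init ⟨θ, hθ⟩, sub_eq_zero, add_comm]
    rfl
  refine norm_le_of_norm_deriv_lt_of_past (a := 0) (y := fun s => x (s + t₀) - ξ s)
    (y' := fun s => f (historySegment δ x (s + t₀)) (α (x (s + t₀) + v (s + t₀))) -
      f (historySegment δ ξ s) (α (ξ s)))
    (b := fun s => η * Real.exp (κ * s)) (b' := fun s => η * (Real.exp (κ * s) * κ))
    (by fun_prop) (by fun_prop)
    (fun t ht => ((hx (t + t₀) (by linarith)).comp_add_const_Ici t₀).sub (hξ.eqn t ht))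
    (fun t ht => ?_) ?_ (fun t ht hpast => ?_) s hs
  · have h1 : HasDerivAt (fun t => Real.exp (κ * t)) (Real.exp (κ * t) * κ) t := by
      simpa using ((hasDerivAt_id t).const_mul κ).exp
    exact h1.const_mul η
  · rw [hhist 0 ⟨by linarith, le_rfl⟩, norm_zero]
    positivity
  · set b := η * Real.exp (κ * t) with hb
    have hηb : η ≤ b := le_mul_of_one_le_right hη.le (Real.one_le_exp (by positivity))
    have hb0 : 0 < b := hη.trans_le hηb
    have hall : ∀ r, -δ ≤ r → r ≤ t → ‖x (r + t₀) - ξ r‖ ≤ b := by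
      intro r hr hrt
      rcases le_total 0 r with h | h
      · refine (hpast r ⟨h, hrt⟩).trans ?_
        rw [hb]
        gcongr
      · rw [hhist r ⟨hr, h⟩, norm_zero]
        exact hb0.le
    have h1 : ‖historySegment δ x (t + t₀) - historySegment δ ξ t‖ ≤ b :=
      norm_historySegment_sub_le hδ fun θ hθ => by
        have := hall (t + θ) (by linarith [hθ.1]) (by linarith [hθ.2])
        rwa [add_right_comm] at this
    have h2 : ‖α (x (t + t₀) + v (t + t₀)) - α (ξ t)‖ ≤ K * (b + b) := by
      refine (hα.norm_sub_le _ _).trans ?_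
      gcongr
      rw [add_sub_right_comm]
      exact (norm_add_le _ _).trans
        (add_le_add (hall t (by linarith) le_rfl) ((hv _ (by linarith)).trans hηb))
    have h3 : η * (Real.exp (κ * t) * κ) = κ * b := by rw [hb]; ring
    rw [h3]
    refine (hf _ _ _ _).trans_lt ?_
    calc _ ≤ L * (b + K * (b + b)) := by gcongr
      _ < κ * b := by rw [hκ]; linarith

/-- Global exponential stability is robust against exponentially decaying perturbations of the
feedback. -/
theorem IsDelayFreeGES.exists_perturbed_decay (hδ : 0 < δ) (hL : 0 < L) (hf0 : f 0 0 = 0)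
    (hf : ∀ φ φ' u u', ‖f φ u - f φ' u'‖ ≤ L * (‖φ - φ'‖ + ‖u - u'‖))
    (hα0 : α 0 = 0) {K : NNReal} (hα : LipschitzWith K α) (hGES : IsDelayFreeGES δ f α) :
    ∃ T C : ℝ, 0 < T ∧ 0 < C ∧ ∀ lam : ℝ, 0 < lam → 3 / 4 ≤ Real.exp (-lam * T) →
      ∀ (x : C(ℝ, EuclideanSpace ℝ (Fin n))) (v : ℝ → EuclideanSpace ℝ (Fin n)) (t₁ V A : ℝ),
      0 < V → C * V ≤ A →
      (∀ t, t₁ ≤ t →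
        HasDerivWithinAt x (f (historySegment δ x t) (α (x t + v t))) (Ici t) t) →
      (∀ t, t₁ ≤ t → ‖v t‖ ≤ V * Real.exp (-lam * (t - t₁))) →
      (∀ t ∈ Icc (t₁ - δ) t₁, ‖x t‖ ≤ A) →
      ∀ t, t₁ ≤ t → ‖x t‖ ≤ C * A * Real.exp (-lam * (t - t₁)) := by
  obtain ⟨a₁, a₂, ha₁, ha₂, hdf⟩ := hGES
  set κ : ℝ := L * (1 + 2 * K) + 1 with hκ
  have hκ0 : 0 < κ := by positivity
  -- After the time T - δ the unperturbed flow has at least halved its initial norm, so the whole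
  -- history segment at time T is halved.
  obtain ⟨T, hTδ, hT⟩ : ∃ T, δ < T ∧ a₁ * Real.exp (-a₂ * (T - δ)) ≤ 1 / 2 := by
    have hlim : Tendsto (fun T => a₁ * Real.exp (-a₂ * (T - δ))) atTop (𝓝 (a₁ * 0)) := by
      refine Tendsto.const_mul _ (Real.tendsto_exp_atBot.comp ?_)
      exact (tendsto_atTop_add_const_right _ (-δ) tendsto_id).const_mul_atTop_of_neg (by linarith)
    rw [mul_zero] at hlim
    obtain ⟨T, h1, h2⟩ := ((eventually_gt_atTop δ).and
      (hlim.eventually_le_const (show (0 : ℝ) < 1 / 2 by norm_num))).exists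
    exact ⟨T, h1, h2⟩
  have hT0 : 0 < T := hδ.trans hTδ
  -- The first summand makes the perturbation cost at most A/4 per period. The second covers the
  -- overshoot a₁ within a period and the loss 4/3 in the last, incomplete period.
  refine ⟨T, 4 * Real.exp (κ * T) + 4 / 3 * (a₁ + 1), hT0, by positivity, ?_⟩
  intro lam hlam hq x v t₁ V A hV hVA hx hv hdata
  set q := Real.exp (-lam * T) with hqdef
  have hVA' : Real.exp (κ * T) * V ≤ A / 4 := by
    have : 0 ≤ 4 / 3 * (a₁ + 1) * V := by positivity
    linarith
  have hA0 : 0 < A := by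
    have : 0 < Real.exp (κ * T) * V := by positivity
    linarith
  have hqpow : ∀ j : ℕ, Real.exp (-lam * (j * T)) = q ^ j := by
    intro j
    rw [hqdef, ← Real.exp_nat_mul]
    congr 1
    ring
  have hstep : ∀ (j : ℕ) (N : ℝ),
      (∀ t ∈ Icc (t₁ + j * T - δ) (t₁ + j * T), ‖x t‖ ≤ N) → ∀ s ∈ Icc 0 T,
      ‖x (s + (t₁ + j * T))‖ ≤ a₁ * N * Real.exp (-a₂ * s) + A / 4 * q ^ j := by
    intro j N hN s hs
    have hjT : 0 ≤ (j : ℝ) * T := by positivity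
    obtain ⟨ξ, hξ⟩ := exists_isDelayFreeSolution hδ hL hf0 hf hα0 hα
      (historySegment δ x (t₁ + j * T))
    have h1 := hdf _ ξ hξ s hs.1
    have hN' : ‖historySegment δ x (t₁ + j * T)‖ ≤ N := norm_historySegment_le hδ hN
    have h2 := norm_perturbed_sub_delayFree_le hδ hL hf hα (η := V * q ^ j) (by positivity)
      (fun t ht => hx t (by linarith))
      (fun t ht => (hv t (by linarith)).trans (by
        rw [← hqpow]
        gcongr V * ?_
        apply Real.exp_le_exp.2
        nlinarith)) hξ hs.1
    have h3 : V * q ^ j * Real.exp (κ * s) ≤ A / 4 * q ^ j := by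
      calc V * q ^ j * Real.exp (κ * s) ≤ V * q ^ j * Real.exp (κ * T) := by
            gcongr
            exact hs.2
        _ = (Real.exp (κ * T) * V) * q ^ j := by ring
        _ ≤ _ := by gcongr
    have h4 : ‖x (s + (t₁ + j * T))‖ ≤ ‖ξ s‖ + ‖x (s + (t₁ + j * T)) - ξ s‖ :=
      norm_le_norm_add_norm_sub' _ _
    have h5 : a₁ * ‖historySegment δ x (t₁ + j * T)‖ * Real.exp (-a₂ * s) ≤
      a₁ * N * Real.exp (-a₂ * s) := by gcongr
    linarith
  -- Each period multiplies the bound on the history window by at most 1/2 + 1/4 = 3/4 ≤ q.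
  have hwin : ∀ j : ℕ, ∀ t ∈ Icc (t₁ + j * T - δ) (t₁ + j * T), ‖x t‖ ≤ A * q ^ j := by
    intro j
    induction j with
    | zero => simpa using hdata
    | succ j ih =>
      intro t ht
      push_cast at ht
      have h1 := hstep j _ ih (t - (t₁ + j * T)) ⟨by linarith [ht.1], by linarith [ht.2]⟩
      rw [sub_add_cancel] at h1
      have h2 : a₁ * (A * q ^ j) * Real.exp (-a₂ * (t - (t₁ + j * T))) ≤ 1 / 2 * (A * q ^ j) := by
        calc a₁ * (A * q ^ j) * Real.exp (-a₂ * (t - (t₁ + j * T)))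
            ≤ a₁ * (A * q ^ j) * Real.exp (-a₂ * (T - δ)) := by
              gcongr 1
              apply Real.exp_le_exp.2
              nlinarith [ht.1]
          _ = (a₁ * Real.exp (-a₂ * (T - δ))) * (A * q ^ j) := by ring
          _ ≤ _ := by gcongr
      have h3 : 3 / 4 * (A * q ^ j) ≤ q * (A * q ^ j) := by gcongr
      calc ‖x t‖ ≤ 3 / 4 * (A * q ^ j) := by linarith
        _ ≤ q * (A * q ^ j) := h3
        _ = A * q ^ (j + 1) := by ring
  intro t ht
  set j := ⌊(t - t₁) / T⌋₊ with hj
  have hj1 : (j : ℝ) * T ≤ t - t₁ := by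
    rw [← le_div_iff₀ hT0]
    exact Nat.floor_le (div_nonneg (by linarith) hT0.le)
  have hj2 : t - t₁ < (j + 1) * T := by
    rw [← div_lt_iff₀ hT0]
    exact Nat.lt_floor_add_one _
  have h1 := hstep j _ (hwin j) (t - (t₁ + j * T)) ⟨by linarith, by linarith⟩
  rw [sub_add_cancel] at h1
  have h2 : a₁ * (A * q ^ j) * Real.exp (-a₂ * (t - (t₁ + j * T))) ≤ a₁ * (A * q ^ j) := by
    refine mul_le_of_le_one_right (by positivity) (Real.exp_le_one_iff.2 ?_)
    have : 0 ≤ t - (t₁ + j * T) := by linarith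
    nlinarith
  have h3 : 3 / 4 * q ^ j ≤ Real.exp (-lam * (t - t₁)) := by
    calc 3 / 4 * q ^ j ≤ q * q ^ j := by gcongr
      _ = q ^ (j + 1) := by ring
      _ = Real.exp (-lam * ((j + 1 : ℕ) * T)) := (hqpow _).symm
      _ ≤ _ := by
        apply Real.exp_le_exp.2
        push_cast
        nlinarith
  calc ‖x t‖ ≤ (a₁ + 1) * A * q ^ j := by
        have : 0 ≤ A * q ^ j := by positivity
        linarith
    _ = 4 / 3 * (a₁ + 1) * A * (3 / 4 * q ^ j) := by ring
    _ ≤ 4 / 3 * (a₁ + 1) * A * Real.exp (-lam * (t - t₁)) := by gcongr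
    _ ≤ _ := by
      gcongr
      linarith [Real.exp_pos (κ * T)]

end Plant

/-! ### The predictor cascade and decay of the closed loop -/

section ClosedLoop

variable {n p : ℕ} {δ d L : ℝ} {m : ℕ}
  {f : C(Set.Icc (-δ) (0 : ℝ), EuclideanSpace ℝ (Fin n)) →
      EuclideanSpace ℝ (Fin p) → EuclideanSpace ℝ (Fin n)}
  {α : EuclideanSpace ℝ (Fin n) → EuclideanSpace ℝ (Fin p)}

/-- `(z, u)` solves the closed loop for some initial data of norm at most `S`. -/
def IsClosedLoopTrajectory (δ d L : ℝ)
    (f : C(Set.Icc (-δ) (0 : ℝ), EuclideanSpace ℝ (Fin n)) →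
      EuclideanSpace ℝ (Fin p) → EuclideanSpace ℝ (Fin n))
    (α : EuclideanSpace ℝ (Fin n) → EuclideanSpace ℝ (Fin p)) (S : ℝ)
    (z : Fin (m + 1) → C(ℝ, EuclideanSpace ℝ (Fin n)))
    (u : ℝ → EuclideanSpace ℝ (Fin p)) : Prop :=
  0 < S ∧ ∃ ψ φ υ, ‖(ψ, φ, υ)‖ ≤ S ∧ IsClosedLoopSolution δ d L m f α ψ φ υ z u

/-- One step of the predictor cascade: if `z_{i-1}` follows the plant dynamics up to an
exponentially decaying residual, then `z_i(t - d/m) - z_{i-1}(t)` decays exponentially. -/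
theorem exists_prediction_error_decay_step (hδ : 0 < δ) (hd : 0 < d) (hL : 0 < L) (hf0 : f 0 0 = 0)
    (hf : ∀ φ φ' u u', ‖f φ u - f φ' u'‖ ≤ L * (‖φ - φ'‖ + ‖u - u'‖))
    (hα0 : α 0 = 0) {K : NNReal} (hα : LipschitzWith K α) {h lam : ℝ} (hh : h = d / m)
    (hlam : 0 < lam) (hkh : (L + 1) * h < 1)
    (hgain : Real.exp (lam * (δ + 3 * h)) *
      (L + (L + 1) / (1 - (L + 1) * h) * (h * (L + (L + 1) * ((L + (L + 1)) * h)))) <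
        (L + 1) / (1 - (L + 1) * h) - lam)
    (i : Fin m) {Cρ : ℝ} (hCρ : 0 < Cρ) :
    ∃ C : ℝ, 0 < C ∧ ∀ S (z : Fin (m + 1) → C(ℝ, EuclideanSpace ℝ (Fin n))) u
      (ρ : ℝ → EuclideanSpace ℝ (Fin n)), IsClosedLoopTrajectory δ d L f α S z u →
      (∀ t, h ≤ t → HasDerivWithinAt (z i.castSucc)
        (f (historySegment δ (z i.castSucc) t) (u (t - d + i * h)) + ρ t) (Ici t) t) →
      (∀ t, h ≤ t → ‖ρ t‖ ≤ Cρ * S * Real.exp (-lam * t)) →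
      ∀ t, h ≤ t →
        ‖z i.succ (t - h) - z i.castSucc t‖ ≤ C * S * Real.exp (-lam * t) := by
  have hm : 0 < m := i.pos
  have hm' : (0 : ℝ) < m := by exact_mod_cast hm
  have hh0 : 0 < h := by rw [hh]; positivity
  have ha : 0 < 1 - (L + 1) * h := by linarith
  set c := (L + 1) / (1 - (L + 1) * h) with hc
  have hc0 : 0 < c := by positivity
  set c₁ := L + c * (h * (L + (L + 1) * ((L + (L + 1)) * h))) with hc₁
  set c₂ := 1 + c * (h * (1 + (L + 1) * h)) with hc₂
  have hc₂0 : 0 < c₂ := by positivity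
  set κ : ℝ := L * (2 + K) + 2 * (L + 1) + 1 with hκ
  have hκ0 : 0 < κ := by positivity
  set r := Real.exp (lam * (δ + 3 * h)) with hr
  have hr0 : 0 < r := Real.exp_pos _
  set γ := c - lam - r * c₁ with hγ
  have hγ0 : 0 < γ := by linarith
  -- The first term dominates the error on the initial interval [h, δ + 4h] through the growth
  -- bound. The second makes γ C exceed r c₂ Cρ, which is the gain inequality with residual.
  set C := 2 * Real.exp ((κ + lam) * (δ + 4 * h)) + 2 * (r * c₂ * Cρ / γ) with hC
  refine ⟨C, by positivity, ?_⟩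
  intro S z u ρ htraj hode hρ
  obtain ⟨hS, ψ, φ, υ, hdata, hz⟩ := htraj
  have hgrow : ∀ s, 0 ≤ s → s ≤ δ + 4 * h → ∀ j, ‖z j s‖ ≤ S * Real.exp (κ * (δ + 4 * h)) :=
    fun s hs0 hs j => (hz.norm_le_exp hδ hd hL hf0 hf hα0 hα hm hS hdata hs0 j).trans (by gcongr)
  refine exp_decay_of_delayed_feedback (e := fun t => z i.succ (t - h) - z i.castSucc t)
    (g := fun t => f (historySegment δ (z i.succ) (t - h)) (u (t - d + i * h)) -
      f (historySegment δ (z i.castSucc) t) (u (t - d + i * h)) - ρ t)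
    (k := L + 1) (W := Cρ * S) (by positivity) hh0 hkh hδ hlam (by fun_prop) ?_ ?_ (by positivity)
    ?_ hc₁ hc₂ ?_
  · intro t ht
    have h1 := hz.predictor i (t - h) (by linarith)
    -- The staggering of the delays: predictor number i + 1, at time t - h, sees the input that its
    -- predecessor sees at time t.
    have e1 : t - h - d + ((i : ℝ) + 1) * d / m = t - d + i * h := by
      rw [hh]; field_simp; ring
    rw [e1, ← hh] at h1
    rw [sub_eq_add_neg t h] at h1
    have h2 := (h1.comp_add_const_Ici (-h)).sub (hode t ht)
    simp only [← sub_eq_add_neg] at h2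
    refine h2.congr_deriv ?_
    abel
  · intro t ht M hM
    have h1 := hf (historySegment δ (z i.succ) (t - h)) (historySegment δ (z i.castSucc) t)
      (u (t - d + i * h)) (u (t - d + i * h))
    rw [sub_self, norm_zero, add_zero] at h1
    refine (norm_sub_le _ _).trans (add_le_add (h1.trans ?_) (hρ t (by linarith)))
    gcongr
    refine norm_historySegment_sub_le hδ fun θ hθ => ?_
    have := hM (t + θ) ⟨by linarith [hθ.1], by linarith [hθ.2]⟩
    rwa [add_sub_right_comm] at this
  · intro s hs
    have h1 := hgrow (s - h) (by linarith [hs.1]) (by linarith [hs.2]) i.succ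
    have h2 := hgrow s (by linarith [hs.1]) hs.2 i.castSucc
    calc ‖z i.succ (s - h) - z i.castSucc s‖
        ≤ 2 * S * Real.exp (κ * (δ + 4 * h)) := by
          refine (norm_sub_le _ _).trans ?_
          linarith
      _ ≤ 2 * S * (Real.exp ((κ + lam) * (δ + 4 * h)) * Real.exp (-lam * s)) := by
          rw [← Real.exp_add]
          gcongr
          nlinarith [hs.2]
      _ = 2 * Real.exp ((κ + lam) * (δ + 4 * h)) * S * Real.exp (-lam * s) := by ring
      _ ≤ _ := by
          gcongr
          rw [hC]
          have : 0 < r * c₂ * Cρ / γ := by positivity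
          linarith
  · have h1 : r * c₂ * Cρ < γ * C := by
      have h2 : γ * C = γ * (2 * Real.exp ((κ + lam) * (δ + 4 * h))) + 2 * (r * c₂ * Cρ) := by
        rw [hC]; field_simp
      have h3 : 0 < r * c₂ * Cρ := by positivity
      have h4 : 0 < γ * (2 * Real.exp ((κ + lam) * (δ + 4 * h))) := by positivity
      linarith
    have h2 := mul_lt_mul_of_pos_right h1 hS
    have h3 : γ * C * S = (c - lam) * (C * S) - r * c₁ * (C * S) := by rw [hγ]; ring
    linarith

/-- All prediction errors `z_i(t - d/m) - z_{i-1}(t)` decay exponentially. -/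
theorem exists_prediction_error_decay (hδ : 0 < δ) (hd : 0 < d) (hL : 0 < L) (hf0 : f 0 0 = 0)
    (hf : ∀ φ φ' u u', ‖f φ u - f φ' u'‖ ≤ L * (‖φ - φ'‖ + ‖u - u'‖))
    (hα0 : α 0 = 0) {K : NNReal} (hα : LipschitzWith K α) {h lam : ℝ} (hh : h = d / m)
    (hlam : 0 < lam) (hkh : (L + 1) * h < 1)
    (hgain : Real.exp (lam * (δ + 3 * h)) *
      (L + (L + 1) / (1 - (L + 1) * h) * (h * (L + (L + 1) * ((L + (L + 1)) * h)))) <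
        (L + 1) / (1 - (L + 1) * h) - lam) (i : Fin m) :
    ∃ C : ℝ, 0 < C ∧ ∀ S (z : Fin (m + 1) → C(ℝ, EuclideanSpace ℝ (Fin n))) u,
      IsClosedLoopTrajectory δ d L f α S z u → ∀ t, h ≤ t →
        ‖z i.succ (t - h) - z i.castSucc t‖ ≤ C * S * Real.exp (-lam * t) := by
  have hm' : (0 : ℝ) < m := by exact_mod_cast i.pos
  have hh0 : 0 < h := by rw [hh]; positivity
  have hres : ∀ j : Fin (m + 1), ∃ C : ℝ, 0 < C ∧
      ∀ S (z : Fin (m + 1) → C(ℝ, EuclideanSpace ℝ (Fin n))) u,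
      IsClosedLoopTrajectory δ d L f α S z u → ∃ ρ : ℝ → EuclideanSpace ℝ (Fin n),
      (∀ t, h ≤ t → HasDerivWithinAt (z j)
        (f (historySegment δ (z j) t) (u (t - d + (j : ℕ) * h)) + ρ t) (Ici t) t) ∧
      ∀ t, h ≤ t → ‖ρ t‖ ≤ C * S * Real.exp (-lam * t) := by
    intro j
    induction j using Fin.induction with
    | zero =>
      refine ⟨1, one_pos, fun S z u htraj => ⟨0, fun t ht => ?_, fun t ht => ?_⟩⟩
      · obtain ⟨-, ψ, φ, υ, -, hz⟩ := htraj
        simpa using hz.plant t (by linarith)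
      · have := htraj.1
        simp only [Pi.zero_apply, norm_zero]
        positivity
    | succ j ih =>
      obtain ⟨Cρ, hCρ, hρ⟩ := ih
      obtain ⟨C, hC, hstep⟩ := exists_prediction_error_decay_step hδ hd hL hf0 hf hα0 hα hh hlam
        hkh hgain j hCρ
      refine ⟨(L + 1) * C, by positivity, fun S z u htraj => ?_⟩
      obtain ⟨ρ, hode, hρ⟩ := hρ S z u htraj
      have he := hstep S z u ρ htraj hode hρ
      -- The residual of a predictor relative to the plant dynamics is its own correction term,
      -- whose decay was just obtained; this closes the induction.
      refine ⟨fun t => -((L + 1) • (z j.succ (t - h) - z j.castSucc t)), fun t ht => ?_,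
        fun t ht => ?_⟩
      · obtain ⟨-, ψ, φ, υ, -, hz⟩ := htraj
        have h1 := hz.predictor j t (by linarith)
        rw [← hh, sub_eq_add_neg (f _ _)] at h1
        have e1 : ((j.succ : ℕ) : ℝ) * h = ((j : ℝ) + 1) * d / m := by
          rw [hh, Fin.val_succ]; push_cast; ring
        rwa [e1]
      · rw [norm_neg, norm_smul, Real.norm_of_nonneg (by positivity)]
        calc _ ≤ (L + 1) * (C * S * Real.exp (-lam * t)) := by gcongr; exact he t ht
          _ = _ := by ring
  obtain ⟨Cρ, hCρ, hρ⟩ := hres i.castSucc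
  obtain ⟨C, hC, hstep⟩ := exists_prediction_error_decay_step hδ hd hL hf0 hf hα0 hα hh hlam
    hkh hgain i hCρ
  refine ⟨C, hC, fun S z u htraj => ?_⟩
  obtain ⟨ρ, hode, hρ⟩ := hρ S z u htraj
  exact hstep S z u ρ htraj hode hρ

/-- If the prediction errors decay, then `z_i(t - i d/m)` approaches the plant state `x(t)`. -/
theorem exists_prediction_decay {h lam : ℝ} (hh : h = d / m) (hd : 0 < d) (hm : 0 < m)
    (hlam : 0 < lam)
    (herr : ∀ i : Fin m, ∃ C : ℝ, 0 < C ∧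
      ∀ S (z : Fin (m + 1) → C(ℝ, EuclideanSpace ℝ (Fin n))) u,
      IsClosedLoopTrajectory δ d L f α S z u → ∀ t, h ≤ t →
        ‖z i.succ (t - h) - z i.castSucc t‖ ≤ C * S * Real.exp (-lam * t)) (i : Fin (m + 1)) :
    ∃ C : ℝ, 0 < C ∧ ∀ S (z : Fin (m + 1) → C(ℝ, EuclideanSpace ℝ (Fin n))) u,
      IsClosedLoopTrajectory δ d L f α S z u → ∀ t, d + h ≤ t →
        ‖z i (t - (i : ℕ) * h) - z 0 t‖ ≤ C * S * Real.exp (-lam * t) := by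
  have hm' : (0 : ℝ) < m := by exact_mod_cast hm
  have hh0 : 0 < h := by rw [hh]; positivity
  induction i using Fin.induction with
  | zero =>
    refine ⟨1, one_pos, fun S z u htraj t ht => ?_⟩
    have := htraj.1
    simp only [Fin.val_zero, Nat.cast_zero, zero_mul, sub_zero, sub_self, norm_zero]
    positivity
  | succ i ih =>
    obtain ⟨C, hC, hi⟩ := ih
    obtain ⟨C', hC', he⟩ := herr i
    refine ⟨C' * Real.exp (lam * d) + C, by positivity, fun S z u htraj t ht => ?_⟩
    have hS := htraj.1
    -- The error is evaluated at t - ih, which is at least h since t ≥ d + h; the shift costs at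
    -- most the factor exp(lam d).
    have hid : (i : ℕ) * h ≤ d := by
      have h1 : ((i : ℕ) : ℝ) ≤ m := by exact_mod_cast i.2.le
      calc ((i : ℕ) : ℝ) * h ≤ m * h := by gcongr
        _ = d := by rw [hh]; field_simp
    have h1 := hi S z u htraj t ht
    rw [Fin.val_castSucc] at h1
    have h2 := he S z u htraj (t - (i : ℕ) * h) (by linarith)
    have e1 : t - ((i.succ : ℕ) : ℝ) * h = t - (i : ℕ) * h - h := by
      rw [Fin.val_succ]; push_cast; ring
    have h3 : C' * S * Real.exp (-lam * (t - (i : ℕ) * h)) ≤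
        C' * S * (Real.exp (lam * d) * Real.exp (-lam * t)) := by
      rw [← Real.exp_add]
      gcongr
      nlinarith
    rw [e1, ← sub_add_sub_cancel _ (z i.castSucc (t - (i : ℕ) * h))]
    calc _ ≤ C' * S * (Real.exp (lam * d) * Real.exp (-lam * t)) + C * S * Real.exp (-lam * t) :=
          (norm_add_le _ _).trans (add_le_add (h2.trans h3) h1)
      _ = _ := by ring

/-- The plant state decays exponentially. -/
theorem exists_plant_decay (hδ : 0 < δ) (hd : 0 < d) (hL : 0 < L) (hf0 : f 0 0 = 0)
    (hf : ∀ φ φ' u u', ‖f φ u - f φ' u'‖ ≤ L * (‖φ - φ'‖ + ‖u - u'‖))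
    (hα0 : α 0 = 0) {K : NNReal} (hα : LipschitzWith K α) (hm : 0 < m)
    {h lam C₀ : ℝ} (hh : h = d / m) (hlam : 0 < lam) (hC₀ : 0 < C₀)
    (hplant : ∀ (x : C(ℝ, EuclideanSpace ℝ (Fin n))) (v : ℝ → EuclideanSpace ℝ (Fin n))
      (t₁ V A : ℝ), 0 < V → C₀ * V ≤ A →
      (∀ t, t₁ ≤ t →
        HasDerivWithinAt x (f (historySegment δ x t) (α (x t + v t))) (Ici t) t) →
      (∀ t, t₁ ≤ t → ‖v t‖ ≤ V * Real.exp (-lam * (t - t₁))) →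
      (∀ t ∈ Icc (t₁ - δ) t₁, ‖x t‖ ≤ A) →
      ∀ t, t₁ ≤ t → ‖x t‖ ≤ C₀ * A * Real.exp (-lam * (t - t₁)))
    (hpred : ∃ C : ℝ, 0 < C ∧ ∀ S (z : Fin (m + 1) → C(ℝ, EuclideanSpace ℝ (Fin n))) u,
      IsClosedLoopTrajectory δ d L f α S z u → ∀ t, d + h ≤ t →
        ‖z (Fin.last m) (t - d) - z 0 t‖ ≤ C * S * Real.exp (-lam * t)) :
    ∃ C : ℝ, 0 < C ∧ ∀ S (z : Fin (m + 1) → C(ℝ, EuclideanSpace ℝ (Fin n))) u,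
      IsClosedLoopTrajectory δ d L f α S z u → ∀ t, 0 ≤ t →
        ‖z 0 t‖ ≤ C * S * Real.exp (-lam * t) := by
  have hm' : (0 : ℝ) < m := by exact_mod_cast hm
  have hh0 : 0 < h := by rw [hh]; positivity
  obtain ⟨Cv, hCv, hv⟩ := hpred
  set κ : ℝ := L * (2 + K) + 2 * (L + 1) + 1 with hκ
  have hκ0 : 0 < κ := by positivity
  -- From t₁ on the prediction estimate holds and the delayed input is feedback, while the history
  -- window [t₁ - δ, t₁] lies in t ≥ 0, where the growth bound applies.
  set t₁ := d + h + δ with ht₁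
  have ht₁0 : 0 < t₁ := by positivity
  set B := Real.exp (κ * t₁) with hB
  -- The plant estimate needs D S to dominate both C₀ times the size of the perturbation and the
  -- history norm.
  set D := C₀ * Cv + B with hD
  have hD0 : 0 < D := by positivity
  refine ⟨(B + C₀ * D) * Real.exp (lam * t₁), by positivity, fun S z u htraj => ?_⟩
  have hvz := hv S z u htraj
  obtain ⟨hS, ψ, φ, υ, hdata, hz⟩ := htraj
  have hgrow : ∀ s, 0 ≤ s → s ≤ t₁ → ‖z 0 s‖ ≤ B * S := fun s hs0 hs =>
    (hz.norm_le_exp hδ hd hL hf0 hf hα0 hα hm hS hdata hs0 0).trans (by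
      rw [mul_comm, hB]; gcongr)
  have hdec := hplant (z 0) (fun t => z (Fin.last m) (t - d) - z 0 t) t₁ (Cv * S) (D * S)
    (by positivity)
    (by
      have : 0 ≤ B * S := by positivity
      rw [hD]; linarith)
    (fun t ht => by
      have h1 := hz.plant t (by linarith)
      rw [hz.feedback (t - d) (by linarith)] at h1
      simpa using h1)
    (fun t ht => (hvz t (by linarith)).trans (by
      gcongr Cv * S * ?_
      apply Real.exp_le_exp.2
      nlinarith))
    (fun t ht => (hgrow t (by linarith [ht.1]) ht.2).trans (by
      gcongr
      rw [hD]
      have : 0 < C₀ * Cv := by positivity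
      linarith))
  intro t ht
  have e1 : ∀ t, Real.exp (-lam * (t - t₁)) = Real.exp (lam * t₁) * Real.exp (-lam * t) := by
    intro t
    rw [← Real.exp_add]
    congr 1
    ring
  have hCD : 0 < C₀ * D := by positivity
  have hB0 : 0 < B := Real.exp_pos _
  rw [mul_assoc _ (Real.exp (lam * t₁)), mul_comm (Real.exp (lam * t₁)), ← mul_assoc,
    mul_assoc _ (Real.exp (lam * t₁)), ← e1]
  rcases le_total t t₁ with h1 | h1
  · refine (hgrow t ht h1).trans ?_
    have h2 : 1 ≤ Real.exp (-lam * (t - t₁)) := Real.one_le_exp (by nlinarith)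
    calc B * S ≤ (B + C₀ * D) * S := by gcongr; linarith
      _ ≤ _ := le_mul_of_one_le_right (by positivity) h2
  · refine (hdec t h1).trans ?_
    rw [← mul_assoc]
    gcongr
    linarith

theorem isClassKL_mul_exp {C lam : ℝ} (hC : 0 < C) (hlam : 0 < lam) :
    IsClassKL fun s t => C * s * Real.exp (-lam * t) where
  continuousOn _ _ := by fun_prop
  strictMonoOn t _ := fun a _ b _ hab => by
    have := Real.exp_pos (-lam * t)
    simp only
    gcongr
  zero _ _ := by simp
  antitoneOn s hs := fun a _ b _ hab => by
    have : 0 ≤ s := hs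
    have h1 : -lam * b ≤ -lam * a := by nlinarith
    simp only
    gcongr
  tendsto s _ := by
    have h1 : Tendsto (fun t => Real.exp (-lam * t)) atTop (𝓝 0) :=
      Real.tendsto_exp_atBot.comp (tendsto_id.const_mul_atTop_of_neg (by linarith))
    simpa using h1.const_mul (C * s)

end ClosedLoop

/-! ### The main theorem -/

theorem theorem1 {n p : ℕ} (δ d L : ℝ) (hδ : 0 < δ) (hd : 0 < d) (hL : 0 < L)
    (f : C(Set.Icc (-δ) (0 : ℝ), EuclideanSpace ℝ (Fin n)) →
      EuclideanSpace ℝ (Fin p) → EuclideanSpace ℝ (Fin n))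
    (hf0 : f 0 0 = 0)
    (hf : ∀ φ φ' u u', ‖f φ u - f φ' u'‖ ≤ L * (‖φ - φ'‖ + ‖u - u'‖))
    (α : EuclideanSpace ℝ (Fin n) → EuclideanSpace ℝ (Fin p))
    (hα0 : α 0 = 0) (hα : ∃ K : NNReal, LipschitzWith K α)
    (hGES : IsDelayFreeGES δ f α)
    (m : ℕ) (hm : (L + 1) ^ 2 * d < m) :
    IsClosedLoopGAS δ d L m f α := by
  obtain ⟨K, hα⟩ := hα
  have hm' : (0 : ℝ) < m := lt_of_le_of_lt (by positivity) hm
  have hm0 : 0 < m := by exact_mod_cast hm'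
  obtain ⟨h, hh⟩ : ∃ h, h = d / m := ⟨_, rfl⟩
  have hh0 : 0 < h := by rw [hh]; positivity
  obtain ⟨hkh, hgain⟩ := delayed_feedback_gain_lt hL hh0 (by
    rw [hh, mul_div_assoc', div_lt_one hm']; exact hm)
  obtain ⟨T, C₀, hT, hC₀, hplant⟩ := hGES.exists_perturbed_decay hδ hL hf0 hf hα0 hα
  -- Both requirements hold strictly at lam = 0, hence by continuity for some small positive lam.
  obtain ⟨lam, hlam, hlamT, hlamgain⟩ : ∃ lam : ℝ, 0 < lam ∧ 3 / 4 ≤ Real.exp (-lam * T) ∧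
      Real.exp (lam * (δ + 3 * h)) *
      (L + (L + 1) / (1 - (L + 1) * h) * (h * (L + (L + 1) * ((L + (L + 1)) * h)))) <
        (L + 1) / (1 - (L + 1) * h) - lam := by
    have h1 : ∀ᶠ lam in 𝓝 (0 : ℝ), 3 / 4 < Real.exp (-lam * T) :=
      ContinuousAt.eventually_lt continuousAt_const (by fun_prop) (by norm_num)
    have h2 : ∀ᶠ lam in 𝓝 (0 : ℝ), Real.exp (lam * (δ + 3 * h)) *
        (L + (L + 1) / (1 - (L + 1) * h) * (h * (L + (L + 1) * ((L + (L + 1)) * h)))) <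
        (L + 1) / (1 - (L + 1) * h) - lam :=
      ContinuousAt.eventually_lt (by fun_prop) (by fun_prop) (by simpa using hgain)
    obtain ⟨lam, ⟨h3, h4⟩, h5⟩ := (((h1.and h2).filter_mono nhdsWithin_le_nhds).and
      (self_mem_nhdsWithin (s := Ioi (0 : ℝ)))).exists
    exact ⟨lam, h5, h3.le, h4⟩
  have herr := exists_prediction_error_decay hδ hd hL hf0 hf hα0 hα hh hlam hkh hlamgain
  have hpred := exists_prediction_decay hh hd hm0 hlam herr (Fin.last m)
  have hmh : ((Fin.last m : ℕ) : ℝ) * h = d := by rw [Fin.val_last, hh]; field_simp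
  rw [hmh] at hpred
  have hx := exists_plant_decay hδ hd hL hf0 hf hα0 hα hm0 hh hlam hC₀
    (hplant lam hlam hlamT) hpred
  have hall : ∀ i : Fin (m + 1), ∃ C : ℝ, 0 < C ∧
      ∀ S (z : Fin (m + 1) → C(ℝ, EuclideanSpace ℝ (Fin n))) u,
      IsClosedLoopTrajectory δ d L f α S z u → ∀ t, 0 ≤ t →
        ‖z i t‖ ≤ C * S * Real.exp (-lam * t) := by
    intro i
    induction i using Fin.induction with
    | zero => exact hx
    | succ i ih =>
      obtain ⟨C, hC, hi⟩ := ih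
      obtain ⟨C', hC', he⟩ := herr i
      refine ⟨C + C', by positivity, fun S z u htraj t ht => ?_⟩
      have hS := htraj.1
      -- z_i(t) is z_{i-1}(t + h) plus the error at time t + h, so decay passes up the chain even
      -- for t near 0.
      have h1 := hi S z u htraj (t + h) (by linarith)
      have h2 := he S z u htraj (t + h) (by linarith)
      rw [add_sub_cancel_right] at h2
      have h3 : Real.exp (-lam * (t + h)) ≤ Real.exp (-lam * t) := by
        apply Real.exp_le_exp.2
        nlinarith
      calc ‖z i.succ t‖ ≤ (C + C') * S * Real.exp (-lam * (t + h)) := by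
            have := norm_le_norm_add_norm_sub' (z i.succ t) (z i.castSucc (t + h))
            linarith
        _ ≤ _ := by gcongr
  choose C hC hbound using hall
  refine ⟨fun s t => (∑ i, C i) * s * Real.exp (-lam * t), isClassKL_mul_exp
    (Finset.sum_pos (fun i _ => hC i) Finset.univ_nonempty) hlam, fun ψ φ υ =>
    ⟨exists_isClosedLoopSolution hδ hd hL hf0 hf hα0 hα ψ φ υ, fun z u hz t ht => ?_⟩⟩
  have hsum : 0 ≤ ∑ i, C i := Finset.sum_nonneg fun i _ => (hC i).le
  -- The barrier arguments are strict and need S > 0, which fails for zero data; the bound is proved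
  -- for every larger S, and S then decreases to the norm of the data.
  have hS : ∀ S, ‖(ψ, φ, υ)‖ < S →
      ‖fun i => z i t‖ ≤ (∑ i, C i) * S * Real.exp (-lam * t) := by
    intro S hS
    have hS0 : 0 < S := (norm_nonneg _).trans_lt hS
    refine (pi_norm_le_iff_of_nonneg (by positivity)).2 fun i => ?_
    refine (hbound i S z u ⟨hS0, ψ, φ, υ, hS.le, hz⟩ t ht).trans ?_
    gcongr
    exact Finset.single_le_sum (fun i _ => (hC i).le) (Finset.mem_univ i)
  have hlim : Tendsto (fun S => (∑ i, C i) * S * Real.exp (-lam * t)) (𝓝[>] ‖(ψ, φ, υ)‖)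
      (𝓝 ((∑ i, C i) * ‖(ψ, φ, υ)‖ * Real.exp (-lam * t))) :=
    (Continuous.tendsto (by fun_prop) _).mono_left nhdsWithin_le_nhds
  exact ge_of_tendsto hlim (by filter_upwards [self_mem_nhdsWithin] with S hS' using hS S hS')
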